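/- Let $0<q<1$, $\alpha\in\mathbb{R}\setminus\{0\}$ and $\beta\ge 0$. Write $(a;p)_\infty=\prod_{j\ge 0}(1-ap^j)$ and $(a;p)_l=(a;p)_\infty/(ap^l;p)_\infty$ for $l\in\mathbb{Z}$. Let $h_n^{(\beta)}(x|q)$, $n\ge 0$, be the symmetric Al-Salam--Chihara polynomials in base $q^{-1}$, generated by $h_0^{(\beta)}=1$, $h_1^{(\beta)}=2x$ and $$2x\,h_n^{(\beta)}(x|q)=h_{n+1}^{(\beta)}(x|q)+q^{-n}(1-q^n)(1+\beta q^{1-n})\,h_{n-1}^{(\beta)}(x|q),\qquad n\ge 1,$$ and let $h_n(x|q)=h_n^{(0)}(x|q)$ be the continuous $q^{-1}$-Hermite polynomials. Let $\lambda_\alpha^{(\beta)}$ be the discrete probability measure on $\mathbb{R}$ supported on the points $x_l(\alpha)=\frac12\bigl(\frac{1}{\alpha q^l}-\alpha q^l\bigr)$, $l\in\mathbb{Z}$, whose mass at $x_l(\alpha)$ is proportional to $$\frac{(-\alpha^2/\beta;q^2)_l}{(-\alpha^2\beta q^2;q^2)_l}\,\alpha^{2l}\beta^l(1+\alpha^2q^{2l})q^{l^2}\quad\text{if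 }\beta>0,\qquad \alpha^{4l}(1+\alpha^2q^{2l})q^{l(2l-1)}\quad\text{if }\beta=0$$ (the latter being the limit of the former as $\beta\downarrow0$). For $\beta>0$ let $$\Phi^{(\beta)}(\sinh y|q)=\frac{(-e^{-2y}/\beta;q^2)_\infty}{(-e^{-2y}\beta q^2;q^2)_\infty}\,e^{-y\left(\frac{i\pi-\log\beta}{\log q}-1\right)},\qquad y\in\mathbb{R}.$$ **Theorem.** The measure $\lambda_\alpha^{(\beta)}$ is well defined (the above masses have a finite positive sum), all polynomials belong to the complex Hilbert space $L^2(\lambda_\alpha^{(\beta)})$, and: 1. The polynomials are dense in $L^2(\lambda_\alpha^{(\beta)})$ if and only if $\beta=0$. 2. If $\beta=0$, the polynomials $\{h_n(x|q)\}_{n\ge0}$ form an orthogonal basis of $L^2(\lambda_\alpha^{(0)})$. 3. If $\beta>0$, the family $\{h_n^{(\beta)}(x|q)\}_{n\ge0}\cup\{\Phi^{(\beta)}(x|q)\,h_n^{(1/(\beta q^2))}(x|q)\}_{n\ge0}$ is an orthogonal basis of $L^2(\lambda_\alpha^{(\beta)})$. In particular, the orthocomplement of the polynomials in $L^2(\lambda_\alpha^{(\beta)})$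 is the closed linear span of $\{\Phi^{(\beta)}(x|q)\,h_n^{(1/(\beta q^2))}(x|q)\}_{n\ge0}$. Here an orthogonal basis is a family of nonzero, pairwise orthogonal elements whose linear span is dense. -/

import Mathlib

open MeasureTheory Polynomial
open scoped ENNReal ComplexConjugate

noncomputable section

/-- The finite `q`-shifted factorial `(a; p)_k = ∏_{j < k} (1 - a p ^ j)`. -/
def qFac (a p : ℂ) (k : ℕ) : ℂ := ∏ j ∈ Finset.range k, (1 - a * p ^ j)

/-- The infinite `q`-shifted factorial `(a; p)_∞` (used for `0 < p < 1`). -/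
def qFacInf (a p : ℝ) : ℝ := ∏' j : ℕ, (1 - a * p ^ j)

/-- The `q`-shifted factorial `(a; p)_l = (a; p)_∞ / (a p ^ l; p)_∞` for `l ∈ ℤ`
(used for `0 < p < 1` and `a < 0`, where no factor vanishes). -/
def qFacInt (a p : ℝ) (l : ℤ) : ℝ := qFacInf a p / qFacInf (a * p ^ l) p

/-- The Al-Salam--Chihara polynomial `P_n(u; a, b | p)` in the base `p`, as a function of `u`,
given by
`(a b; p)_n / a ^ n * ₃φ₂(p ^ (-n), a u, a / u; a b, 0; p, p)`. -/
def alSalamChihara (p a b u : ℂ) (n : ℕ) : ℂ :=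
  qFac (a * b) p n / a ^ n *
    ∑ k ∈ Finset.range (n + 1),
      qFac ((p ^ n)⁻¹) p k * qFac (a * u) p k * qFac (a / u) p k /
        (qFac (a * b) p k * qFac p p k) * p ^ k

/-- The symmetric Al-Salam--Chihara polynomial `h_n^{(β)}(x | q)`, generated by its three-term
recurrence; for `β = 0` this is the continuous `q⁻¹`-Hermite polynomial `h_n(x | q)`.
For `β > 0`, `symASC_eval` below identifies it with the hypergeometric expression. -/
def symASC (q β : ℝ) : ℕ → ℝ[X]
  | 0 => 1
  | 1 => 2 * X
  | n + 2 => 2 * X * symASC q β (n + 1) -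
      C ((q ^ (n + 1))⁻¹ * (1 - q ^ (n + 1)) * (1 + β * (q ^ n)⁻¹)) * symASC q β n

theorem qFac_zero (a p : ℂ) : qFac a p 0 = 1 := by simp [qFac]

theorem qFac_succ (a p : ℂ) (k : ℕ) : qFac a p (k + 1) = qFac a p k * (1 - a * p ^ k) := by
  simp [qFac, Finset.prod_range_succ]

theorem qFac_succ' (a p : ℂ) (k : ℕ) : qFac a p (k + 1) = (1 - a) * qFac (a * p) p k := by
  simp only [qFac, Finset.prod_range_succ', pow_zero, mul_one]
  rw [mul_comm]
  congr 1
  refine Finset.prod_congr rfl fun j _ => ?_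
  ring

theorem qFac_eq_zero {p : ℂ} (hp : p ≠ 0) {n k : ℕ} (h : n < k) :
    qFac ((p ^ n)⁻¹) p k = 0 := by
  refine Finset.prod_eq_zero (Finset.mem_range.2 h) ?_
  rw [inv_mul_cancel₀ (pow_ne_zero _ hp), sub_self]

/-- The terms of the `₃φ₂`-series. -/
def ascTerm (p a b u : ℂ) (n k : ℕ) : ℂ :=
  qFac ((p ^ n)⁻¹) p k * qFac (a * u) p k * qFac (a / u) p k /
    (qFac (a * b) p k * qFac p p k) * p ^ k

theorem sum_ascTerm {p : ℂ} (hp : p ≠ 0) (a b u : ℂ) {n N : ℕ} (h : n < N) :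
    ∑ k ∈ Finset.range N, ascTerm p a b u n k =
      ∑ k ∈ Finset.range (n + 1), ascTerm p a b u n k := by
  symm
  refine Finset.sum_subset (Finset.range_mono h) fun k _ hk => ?_
  rw [Finset.mem_range, not_lt] at hk
  simp [ascTerm, qFac_eq_zero hp (show n < k from hk)]

theorem ascTerm_partial {p a b u : ℂ} (hp : p ≠ 0) (hp1 : ∀ k, qFac p p k ≠ 0)
    (hab : ∀ k, qFac (a * b) p k ≠ 0) (hu : u ≠ 0) (n N : ℕ) :
    ∑ k ∈ Finset.range (N + 1), (a * (u + u⁻¹) * ascTerm p a b u (n + 1) k -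
      ((1 - a * b * p ^ (n + 1)) * ascTerm p a b u (n + 2) k +
        (a ^ 2 + a * b) * p ^ (n + 1) * ascTerm p a b u (n + 1) k +
        a ^ 2 * (1 - p ^ (n + 1)) * ascTerm p a b u n k)) =
    -(qFac ((p ^ (n + 1))⁻¹) p N * qFac (a * u) p (N + 1) * qFac (a / u) p (N + 1) /
      (qFac (a * b) p N * qFac p p N)) := by
  induction N with
  | zero =>
    simp only [zero_add, Finset.sum_range_one, ascTerm, qFac_zero, qFac_succ, pow_zero]
    field_simp
    ring
  | succ N ih =>
    rw [Finset.sum_range_succ, ih]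
    have e1 : qFac ((p ^ (n + 1))⁻¹) p (N + 1) =
        qFac ((p ^ (n + 1))⁻¹) p N * (1 - (p ^ (n + 1))⁻¹ * p ^ N) := qFac_succ _ _ _
    have e2 : qFac ((p ^ (n + 2))⁻¹) p (N + 1) =
        (1 - (p ^ (n + 2))⁻¹) * qFac ((p ^ (n + 1))⁻¹) p N := by
      rw [qFac_succ']
      congr 2
      field_simp
      ring
    have e3 : (1 - p ^ (n + 1)) * qFac ((p ^ n)⁻¹) p (N + 1) =
        -p ^ (n + 1) * (qFac ((p ^ (n + 1))⁻¹) p N * (1 - (p ^ (n + 1))⁻¹ * p ^ N) *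
          (1 - (p ^ (n + 1))⁻¹ * p ^ (N + 1))) := by
      rw [← qFac_succ, ← qFac_succ, qFac_succ' _ _ (N + 1)]
      have : (p ^ (n + 1))⁻¹ * p = (p ^ n)⁻¹ := by
        field_simp
        ring
      rw [this]
      field_simp
      ring
    have e4 : a ^ 2 * (1 - p ^ (n + 1)) * ascTerm p a b u n (N + 1) =
        a ^ 2 * ((1 - p ^ (n + 1)) * qFac ((p ^ n)⁻¹) p (N + 1)) *
          (qFac (a * u) p (N + 1) * qFac (a / u) p (N + 1) /
            (qFac (a * b) p (N + 1) * qFac p p (N + 1)) * p ^ (N + 1)) := by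
      simp only [ascTerm]
      ring
    rw [e4, e3]
    simp only [ascTerm]
    rw [e1, e2]
    have d1 := hab N
    have d2 := hp1 N
    have d3 := hab (N + 1)
    have d4 := hp1 (N + 1)
    rw [qFac_succ] at d3 d4
    have d5 := right_ne_zero_of_mul d3
    have d6 := right_ne_zero_of_mul d4
    rw [qFac_succ (a * u) p (N + 1), qFac_succ (a / u) p (N + 1), qFac_succ (a * b) p N,
      qFac_succ p p N]
    generalize qFac (a * u) p (N + 1) = g1
    generalize qFac (a / u) p (N + 1) = g2
    generalize qFac (a * b) p N = D1 at *
    generalize qFac p p N = D2 at *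
    generalize qFac ((p ^ (n + 1))⁻¹) p N = s
    have hN := pow_ne_zero N hp
    have hn := pow_ne_zero n hp
    clear e1 e2 e3 e4 ih hab hp1 d3 d4
    generalize a * b = c at *
    simp only [pow_succ]
    generalize p ^ N = w at *
    generalize p ^ n = r at *
    rw [mul_comm c w] at d5 ⊢
    field_simp
    ring

theorem alSalamChihara_recurrence {p a b u : ℂ} (hp : p ≠ 0) (hp1 : ∀ k, qFac p p k ≠ 0)
    (hab : ∀ k, qFac (a * b) p k ≠ 0) (ha : a ≠ 0) (hu : u ≠ 0) (n : ℕ) :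
    (u + u⁻¹) * alSalamChihara p a b u (n + 1) =
      alSalamChihara p a b u (n + 2) + (a + b) * p ^ (n + 1) * alSalamChihara p a b u (n + 1) +
        (1 - p ^ (n + 1)) * (1 - a * b * p ^ n) * alSalamChihara p a b u n := by
  have h := ascTerm_partial hp hp1 hab hu n (n + 2)
  rw [qFac_eq_zero hp (show n + 1 < n + 2 by omega)] at h
  simp only [Finset.sum_sub_distrib, Finset.sum_add_distrib, ← Finset.mul_sum] at h
  rw [sum_ascTerm hp a b u (show n + 1 < n + 2 + 1 by omega),
    sum_ascTerm hp a b u (show n < n + 2 + 1 by omega)] at h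
  have hP : ∀ m, alSalamChihara p a b u m = qFac (a * b) p m / a ^ m *
    ∑ k ∈ Finset.range (m + 1), ascTerm p a b u m k := fun m => rfl
  rw [hP, hP, hP, qFac_succ _ _ (n + 1), qFac_succ _ _ n]
  generalize ∑ k ∈ Finset.range (n + 1 + 1), ascTerm p a b u (n + 1) k = T1 at *
  generalize ∑ k ∈ Finset.range (n + 2 + 1), ascTerm p a b u (n + 2) k = T2 at *
  generalize ∑ k ∈ Finset.range (n + 1), ascTerm p a b u n k = T0 at *
  have han := pow_ne_zero n ha
  have h' : a * (u + u⁻¹) * T1 = (1 - a * b * p ^ (n + 1)) * T2 +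
      (a ^ 2 + a * b) * p ^ (n + 1) * T1 + a ^ 2 * (1 - p ^ (n + 1)) * T0 := by
    simp only [zero_mul, zero_div, neg_zero] at h
    linear_combination h
  have key : (u + u⁻¹) * (qFac (a * b) p n * (1 - a * b * p ^ n) / a ^ (n + 1) * T1) =
      qFac (a * b) p n * (1 - a * b * p ^ n) / a ^ (n + 2) * (a * (u + u⁻¹) * T1) := by
    simp only [pow_succ]
    field_simp
  rw [key, h']
  simp only [pow_succ]
  field_simp

/-- The symmetric Al-Salam--Chihara polynomials are
`h_n^{(β)}(sinh y | q) = i ^ n P_n(i e^{-y}; √β, -√β | q⁻¹)` for `β > 0`. -/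
theorem symASC_eval {q β : ℝ} (hq0 : 0 < q) (hq1 : q < 1) (hβ : 0 < β) (y : ℝ) (n : ℕ) :
    (((symASC q β n).eval (Real.sinh y) : ℝ) : ℂ) =
      Complex.I ^ n * alSalamChihara ((q : ℂ)⁻¹) (Real.sqrt β) (-(Real.sqrt β : ℂ))
        (Complex.I * Complex.exp (-y)) n := by
  have hq : (q : ℂ)⁻¹ ≠ 0 := by simpa using hq0.ne'
  have hs : (Real.sqrt β : ℂ) ≠ 0 := by
    exact_mod_cast (Real.sqrt_pos.2 hβ).ne'
  have hss : (Real.sqrt β : ℂ) * (Real.sqrt β : ℂ) = β := by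
    exact_mod_cast Real.mul_self_sqrt hβ.le
  have hu : Complex.I * Complex.exp (-y) ≠ 0 :=
    mul_ne_zero Complex.I_ne_zero (Complex.exp_ne_zero _)
  have hX : Complex.I * Complex.exp (-y) + (Complex.I * Complex.exp (-y))⁻¹ =
      -(2 * Complex.I * (Real.sinh y : ℂ)) := by
    rw [Complex.ofReal_sinh, Complex.sinh, mul_inv, Complex.inv_I, ← Complex.exp_neg, neg_neg]
    ring
  have hp1 : ∀ k, qFac ((q : ℂ)⁻¹) ((q : ℂ)⁻¹) k ≠ 0 := by
    intro k
    refine Finset.prod_ne_zero_iff.2 fun j _ => ?_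
    rw [← pow_succ', sub_ne_zero]
    intro h
    have h2 : (1 : ℝ) = (q⁻¹) ^ (j + 1) := by exact_mod_cast h
    exact (one_lt_pow₀ ((one_lt_inv₀ hq0).2 hq1) (Nat.succ_ne_zero j)).ne h2
  have hab : ∀ k, qFac ((Real.sqrt β : ℂ) * -(Real.sqrt β : ℂ)) ((q : ℂ)⁻¹) k ≠ 0 := by
    intro k
    refine Finset.prod_ne_zero_iff.2 fun j _ => ?_
    rw [mul_neg, hss]
    have h2 : (1 + β * (q⁻¹) ^ j : ℝ) ≠ 0 := by positivity
    intro h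
    apply h2
    have : ((1 + β * (q⁻¹) ^ j : ℝ) : ℂ) = 0 := by
      rw [← h]; push_cast; ring
    exact_mod_cast this
  induction n using Nat.twoStepInduction with
  | zero => simp [symASC, alSalamChihara, qFac]
  | one =>
    have h1 := hab 1
    have h2 := hp1 1
    have hI : Complex.I * Complex.I = -1 := Complex.I_mul_I
    have hP : alSalamChihara ((q : ℂ)⁻¹) (Real.sqrt β) (-(Real.sqrt β : ℂ))
        (Complex.I * Complex.exp (-y)) 1 =
        Complex.I * Complex.exp (-y) + (Complex.I * Complex.exp (-y))⁻¹ := by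
      simp only [qFac, Finset.prod_range_one, pow_zero, mul_one] at h1 h2
      simp only [alSalamChihara, qFac, Finset.sum_range_succ, Finset.sum_range_zero,
        Finset.prod_range_one, Finset.prod_range_zero, pow_zero, pow_one, mul_one, zero_add]
      generalize Complex.I * Complex.exp (-y) = u at *
      generalize (Real.sqrt β : ℂ) = a at *
      generalize (q : ℂ)⁻¹ = p at *
      have h3 : 1 + a ^ 2 ≠ 0 := by
        intro h
        apply h1
        linear_combination h
      have e : 1 - a * -a = 1 + a ^ 2 := by ring
      simp only [e]
      field_simp
      ring
    rw [hP, hX]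
    simp only [symASC]
    simp only [eval_mul, eval_X, eval_ofNat, pow_one]
    push_cast
    linear_combination (2 * Complex.sinh y) * hI
  | more n ih0 ih1 =>
    have hr := alSalamChihara_recurrence hq hp1 hab hs hu n
    rw [hX, add_neg_cancel, zero_mul, zero_mul, add_zero] at hr
    have hr' := eq_sub_of_add_eq hr.symm
    rw [hr']
    have hI : Complex.I ^ 2 = -1 := Complex.I_sq
    simp only [symASC]
    simp only [eval_sub, eval_mul, eval_X, eval_ofNat, eval_C]
    push_cast
    rw [ih0, ih1]
    have hq' : (q : ℂ) ≠ 0 := by exact_mod_cast hq0.ne'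
    have hc : ((q : ℂ) ^ (n + 1))⁻¹ * (1 - (q : ℂ) ^ (n + 1)) = ((q : ℂ) ^ (n + 1))⁻¹ - 1 := by
      rw [mul_sub, mul_one, inv_mul_cancel₀ (pow_ne_zero _ hq')]
    rw [mul_neg, hss, hc, inv_pow, inv_pow]
    generalize alSalamChihara _ _ _ _ (n + 1) = A1
    generalize alSalamChihara _ _ _ _ n = A0
    linear_combination (2 * Complex.sinh y * A1 * Complex.I ^ (n + 1) +
      (1 - ((q : ℂ) ^ (n + 1))⁻¹) * (1 + β * ((q : ℂ) ^ n)⁻¹) * Complex.I ^ n * A0) * hI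

/-- The grid point `x_l(α) = (1 / (α q ^ l) - α q ^ l) / 2`, `l ∈ ℤ`. -/
def gridPoint (q α : ℝ) (l : ℤ) : ℝ := (1 / (α * q ^ l) - α * q ^ l) / 2

/-- The unnormalized mass at `x_l(α)` in the discrete orthogonality relation of the polynomials
`h_n^{(β)}(x | q)`. The expression for `β = 0` is the limit as `β ↓ 0` of the one for `β > 0`. -/
def ascWeight (q α β : ℝ) (l : ℤ) : ℝ :=
  if β = 0 then
    α ^ (4 * l) * (1 + α ^ 2 * q ^ (2 * l)) * q ^ (l * (2 * l - 1))
  else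
    qFacInt (-α ^ 2 / β) (q ^ 2) l / qFacInt (-α ^ 2 * β * q ^ 2) (q ^ 2) l *
      α ^ (2 * l) * β ^ l * (1 + α ^ 2 * q ^ (2 * l)) * q ^ (l ^ 2)

/-- The discrete measure `λ_α^{(β)}` on `ℝ`, normalized to total mass one. -/
def ascMeasure (q α β : ℝ) : Measure ℝ :=
  Measure.sum fun l : ℤ =>
    ENNReal.ofReal (ascWeight q α β l / ∑' m : ℤ, ascWeight q α β m) •
      Measure.dirac (gridPoint q α l)

/-- The function `Φ^{(β)}(x | q)`, with `x = sinh y`. -/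
def ascPhi (q β x : ℝ) : ℂ :=
  let y := Real.arsinh x
  ((qFacInf (-Real.exp (-2 * y) / β) (q ^ 2) /
      qFacInf (-Real.exp (-2 * y) * β * q ^ 2) (q ^ 2) : ℝ) : ℂ) *
    Complex.exp (-y * ((Complex.I * Real.pi - Real.log β) / Real.log q - 1))

/-- `h_n^{(β)}(x | q)` as a complex-valued function of `x`. -/
def ascFun (q β : ℝ) (n : ℕ) (x : ℝ) : ℂ := (((symASC q β n).eval x : ℝ) : ℂ)

/-- `Φ^{(β)}(x | q) h_n^{(1 / (β q ^ 2))}(x | q)`. -/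
def ascDualFun (q β : ℝ) (n : ℕ) (x : ℝ) : ℂ := ascPhi q β x * ascFun q (1 / (β * q ^ 2)) n x

/-- The polynomial functions on `ℝ` with complex coefficients. -/
def polyFun (p : ℂ[X]) (x : ℝ) : ℂ := p.eval (x : ℂ)

/-- The linear span in `L²(μ)` of (the classes of) the functions `f i`. -/
def l2Span {ι : Type*} (μ : Measure ℝ) (f : ι → ℝ → ℂ) : Submodule ℂ (Lp ℂ 2 μ) :=
  Submodule.span ℂ {g : Lp ℂ 2 μ | ∃ i, g =ᵐ[μ] f i}

/-- The functions `f i` form an orthogonal basis of `L²(μ)`: they are square integrable, nonzero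
and pairwise orthogonal in `L²(μ)`, and their linear span is dense. -/
def IsOrthogonalBasisL2 {ι : Type*} (μ : Measure ℝ) (f : ι → ℝ → ℂ) : Prop :=
  (∀ i, MemLp (f i) 2 μ) ∧ (∀ i, ¬ f i =ᵐ[μ] 0) ∧
    (∀ i j, i ≠ j → ∫ x, f i x * conj (f j x) ∂μ = 0) ∧
    (l2Span μ f).topologicalClosure = ⊤

end

/-!
The proof diagonalizes an explicit second-order `q`-difference operator on the grid. With
`s = α² q^{2l}`, put

  `(L f)(x_l) = A(s) f(x_{l-1}) + C(s) f(x_l) + B(s) f(x_{l+1})`,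

where `A = q (1 + β s) / ((1 + s) (q + s))`, `B(s) = A(1 / s)` and `C = 1 - A - B`. The weight
satisfies the detailed balance `w_{l+1} A(s_{l+1}) = w_l B(s_l)` (`ascWeight_add_one`), so `L` is
symmetric on `L²` of the measure. In the orthonormal basis of normalized indicator functions of the
grid points (`gridBasis`), it becomes a real Jacobi matrix with off-diagonal `√(A(s_l) B(s_{l-1}))`.

*Eigenfunctions.* The polynomial `h_n^{(β)}` satisfies `L h = q^n h` (`symASC_eigen`). For `β > 0`,
multiplication by `Φ` intertwines `L` with `-β q` times the same operator for the parameter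
`1 / (β q²)` (`coefA_mul_ascPhi`, `coefB_mul_ascPhi`, `coefC_dual`), so that `Φ h_n^{(1/(β q²))}` is
an eigenfunction for the eigenvalue `-β q^{n+1}`. All these eigenvalues are distinct, which gives
the orthogonality of all functions in question (`IsJacobiEigen.inner_eq_zero`).

*Completeness.* The squared Hilbert--Schmidt norm of `L` is a telescoping sum (`hsPrim_sub`) with
value `(1 + β² q²) / (1 - q²)`, which is exactly the sum of the squares of the eigenvalues found.
Equality in Bessel's inequality then shows that `L` vanishes on the orthogonal complement of the
eigenfunctions (`inner_eq_zero_of_hilbertSchmidt`). Finally `L` has no square summable null vector: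
for `β > 0` the off-diagonal entries decay geometrically and dominate the diagonal, which makes
every nonzero solution of the three-term recurrence unbounded; for `β = 0`, where all entries have
the same order, the recurrence is reduced to a first-order one (`eq_zero_of_jacobi_kernel`).

For `β > 0` the functions `Φ h_n^{(1/(β q²))}` are nonzero and orthogonal to the polynomials, so the
latter are not dense.
-/

noncomputable section

/-! ### The second-order q-difference operator -/

/-- The coefficient of `f (x_{l-1})` in the operator
`(L f)(x_l) = A f(x_{l-1}) + C f(x_l) + B f(x_{l+1})`, as a function of `s = α² q^{2l}`. -/
def coefA (q β s : ℝ) : ℝ := q * (1 + β * s) / ((1 + s) * (q + s))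

/-- The coefficient of `f (x_{l+1})` in the operator `L`, as a function of `s = α² q^{2l}`. -/
def coefB (q β s : ℝ) : ℝ := q * s * (s + β) / ((1 + s) * (1 + q * s))

/-- The coefficient `1 - A - B` of `f (x_l)` in the operator `L`, as a function of
`s = α² q^{2l}`. -/
def coefC (q β s : ℝ) : ℝ := s * (1 + q) * (1 - β * q) / ((q + s) * (1 + q * s))

theorem coefA_add_coefB {q s : ℝ} (β : ℝ) (hq : 0 < q) (hs : 0 < s) :
    coefA q β s + coefB q β s = 1 - coefC q β s := by
  have h1 : 1 + s ≠ 0 := by positivity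
  have h2 : q + s ≠ 0 := by positivity
  have h3 : 1 + q * s ≠ 0 := by positivity
  rw [coefA, coefB, coefC]
  field_simp
  ring

theorem coefA_pos {q β s : ℝ} (hq : 0 < q) (hβ : 0 ≤ β) (hs : 0 < s) : 0 < coefA q β s := by
  rw [coefA]; positivity

theorem coefB_pos {q β s : ℝ} (hq : 0 < q) (hβ : 0 ≤ β) (hs : 0 < s) : 0 < coefB q β s := by
  rw [coefB]; positivity

theorem coefA_inv {q s : ℝ} (β : ℝ) (hq : 0 < q) (hs : 0 < s) :
    coefA q β s⁻¹ = coefB q β s := by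
  rw [coefA, coefB]
  field_simp
  ring

/-- `2 x_l` as a function of `u = α q^l`. -/
def dblX (u : ℝ) : ℝ := u⁻¹ - u

theorem symASC_eval_succ_succ (q β x : ℝ) (n : ℕ) :
    (symASC q β (n + 2)).eval x = 2 * x * (symASC q β (n + 1)).eval x -
      ((q ^ (n + 1))⁻¹ * (1 - q ^ (n + 1)) * (1 + β * (q ^ n)⁻¹)) *
        (symASC q β n).eval x := by
  simp [symASC]

/-- The symmetric Al-Salam--Chihara polynomials are eigenfunctions of `L`. The induction carries
along the value of `L` on `2 x h_n`, which closes up because the two shifted values of `2 x` have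
sum `(q + q⁻¹) 2 x` and product `(2 x) ^ 2 - (q⁻¹ - q) ^ 2`. -/
theorem symASC_eigen_aux {q u : ℝ} (β : ℝ) (hq : 0 < q) (hu : u ≠ 0) (n : ℕ) :
    coefA q β (u ^ 2) * (symASC q β n).eval (dblX (u / q) / 2) +
        coefB q β (u ^ 2) * (symASC q β n).eval (dblX (u * q) / 2) =
      (q ^ n - coefC q β (u ^ 2)) * (symASC q β n).eval (dblX u / 2) ∧
    coefA q β (u ^ 2) * dblX (u / q) * (symASC q β n).eval (dblX (u / q) / 2) +
        coefB q β (u ^ 2) * dblX (u * q) * (symASC q β n).eval (dblX (u * q) / 2) =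
      (q ^ (n + 1) - coefC q β (u ^ 2)) * dblX u * (symASC q β n).eval (dblX u / 2) +
        q ^ n / q * (1 - q ^ 2) * (dblX u * (symASC q β n).eval (dblX u / 2) -
          (symASC q β (n + 1)).eval (dblX u / 2)) := by
  have hs : 0 < u ^ 2 := by positivity
  have hAB := coefA_add_coefB β hq hs
  -- `C` is a rational function of `2 x`.
  have hCX : coefC q β (u ^ 2) * (q * dblX u ^ 2 + (1 + q) ^ 2) = (1 + q) * (1 - β * q) := by
    have h2 : q + u ^ 2 ≠ 0 := by positivity
    have h3 : 1 + q * u ^ 2 ≠ 0 := by positivity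
    rw [coefC, dblX]
    field_simp
    ring
  -- The action of `L` on `2 x`, that is, the second assertion for `n = 0`.
  have hABX : coefA q β (u ^ 2) * dblX (u / q) + coefB q β (u ^ 2) * dblX (u * q) =
      (q - coefC q β (u ^ 2)) * dblX u := by
    have h1 : 1 + u ^ 2 ≠ 0 := by positivity
    have h2 : q + u ^ 2 ≠ 0 := by positivity
    have h3 : 1 + q * u ^ 2 ≠ 0 := by positivity
    rw [coefA, coefB, coefC, dblX, dblX, dblX]
    field_simp
    ring
  have hsum : dblX (u / q) + dblX (u * q) = (q + q⁻¹) * dblX u := by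
    simp only [dblX]
    field_simp
    ring
  have hprod : dblX (u / q) * dblX (u * q) = dblX u ^ 2 - (q⁻¹ - q) ^ 2 := by
    simp only [dblX]
    field_simp
    ring
  generalize coefA q β (u ^ 2) = A at *
  generalize coefB q β (u ^ 2) = B at *
  generalize coefC q β (u ^ 2) = K at *
  generalize dblX (u / q) = Xm at *
  generalize dblX (u * q) = Xp at *
  generalize dblX u = X at *
  have e1 : ∀ Y : ℝ, (symASC q β 1).eval (Y / 2) = Y := by
    intro Y
    simp [symASC]
    ring
  have e0 : ∀ Y : ℝ, (symASC q β 0).eval (Y / 2) = 1 := by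
    intro Y
    simp [symASC]
  have e2 : ∀ (Y : ℝ) (n : ℕ), (symASC q β (n + 2)).eval (Y / 2) =
      Y * (symASC q β (n + 1)).eval (Y / 2) -
      ((q ^ (n + 1))⁻¹ * (1 - q ^ (n + 1)) * (1 + β * (q ^ n)⁻¹)) *
        (symASC q β n).eval (Y / 2) := by
    intro Y n
    rw [symASC_eval_succ_succ]
    ring
  have hq' := hq.ne'
  induction n using Nat.twoStepInduction with
  | zero =>
    simp only [zero_add, e1, e0]
    constructor
    · linear_combination hAB
    · linear_combination hABX
  | one =>
    simp only [e1, e2, zero_add, e0, Nat.reduceAdd]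
    constructor
    · linear_combination hABX
    · linear_combination (norm := skip) (Xm + Xp) * hABX - Xm * Xp * hAB +
        (q - K) * X * hsum - (1 - K) * hprod - (1 - q) ^ 2 / q ^ 2 * hCX
      field_simp
      ring
  | more n ih0 ih1 =>
    obtain ⟨ih0, ih0'⟩ := ih0
    obtain ⟨ih1, ih1'⟩ := ih1
    simp only [e2 _ n, e2 _ (n + 1)] at *
    generalize eval (Xm / 2) (symASC q β n) = m0 at *
    generalize eval (Xp / 2) (symASC q β n) = p0 at *
    generalize eval (X / 2) (symASC q β n) = h0 at *
    generalize eval (Xm / 2) (symASC q β (n + 1)) = m1 at *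
    generalize eval (Xp / 2) (symASC q β (n + 1)) = p1 at *
    generalize eval (X / 2) (symASC q β (n + 1)) = h1 at *
    have hz : q ^ n ≠ 0 := pow_ne_zero n hq'
    simp only [pow_succ] at *
    generalize q ^ n = z at *
    set c := (z * q)⁻¹ * (1 - z * q) * (1 + β * z⁻¹) with hc
    constructor
    · linear_combination (norm := skip) ih1' - c * ih0
      rw [hc]
      field_simp
      ring
    · linear_combination (norm := skip) (Xm + Xp) * ih1' - Xm * Xp * ih1 - c * ih0' +
        ((z * q * q - K) * X * h1 +
          z * q / q * (1 - 1 * q * q) * (X * h1 - (X * h1 - c * h0))) * hsum -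
        (z * q - K) * h1 * hprod - (1 - q) ^ 2 / q ^ 2 * h1 * hCX
      rw [hc]
      field_simp
      ring

theorem symASC_eigen {q u : ℝ} (β : ℝ) (hq : 0 < q) (hu : u ≠ 0) (n : ℕ) :
    coefA q β (u ^ 2) * (symASC q β n).eval (dblX (u / q) / 2) +
        coefC q β (u ^ 2) * (symASC q β n).eval (dblX u / 2) +
        coefB q β (u ^ 2) * (symASC q β n).eval (dblX (u * q) / 2) =
      q ^ n * (symASC q β n).eval (dblX u / 2) := by
  linear_combination (symASC_eigen_aux β hq hu n).1

/-- A rational function whose increments along `s ↦ q² s` are the squared column norms of the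
symmetrized matrix of `L`, so that its Hilbert--Schmidt norm is a telescoping sum. -/
def hsPrim (q β s : ℝ) : ℝ :=
  (q * (1 - β * q) ^ 2 * (1 + q ^ 2) / (s + q) -
    q * (1 - β * q ^ 2) * (1 - β) * (1 / (s + 1) + q ^ 2 / (s + q ^ 2))) /
    ((1 - q) ^ 2 * (1 - q ^ 2))

theorem hsPrim_zero {q : ℝ} (β : ℝ) (hq0 : 0 < q) (hq1 : q < 1) :
    hsPrim q β 0 = (1 + (β * q) ^ 2) / (1 - q ^ 2) := by
  have h1 : 1 - q ≠ 0 := by linarith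
  have h2 : 1 - q ^ 2 ≠ 0 := by nlinarith
  rw [hsPrim]
  field_simp
  ring

theorem hsPrim_sub {q s : ℝ} (β : ℝ) (hq0 : 0 < q) (hq1 : q < 1) (hs : 0 < s) :
    hsPrim q β (s * q ^ 2) - hsPrim q β s =
      coefA q β s * coefB q β (s / q ^ 2) + coefC q β s ^ 2 +
        coefA q β (s * q ^ 2) * coefB q β s := by
  have h1 : 1 - q ≠ 0 := by linarith
  have h2 : 1 + q ≠ 0 := by linarith
  have h3 : 1 - q ^ 2 = (1 - q) * (1 + q) := by ring
  rw [hsPrim, hsPrim, coefA, coefB, coefC, coefA, coefB, h3]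
  have f1 : s / q ^ 2 + β = (s + β * q ^ 2) / q ^ 2 := by field_simp
  have f2 : 1 + s / q ^ 2 = (s + q ^ 2) / q ^ 2 := by field_simp; ring
  have f3 : 1 + q * (s / q ^ 2) = (s + q) / q := by field_simp; ring
  have f4 : q + s * q ^ 2 = q * (1 + q * s) := by ring
  have f5 : s * q ^ 2 + q ^ 2 = q ^ 2 * (1 + s) := by ring
  have f6 : s * q ^ 2 + q = q * (1 + q * s) := by ring
  have f7 : s * q ^ 2 + 1 = 1 + s * q ^ 2 := by ring
  have f8 : q + s = s + q := by ring
  have f9 : s + 1 = 1 + s := by ring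
  rw [f1, f2, f3, f4, f5, f6, f7, f8, f9]
  have g1 : 1 + s ≠ 0 := by positivity
  have g2 : s + q ≠ 0 := by positivity
  have g3 : s + q ^ 2 ≠ 0 := by positivity
  have g4 : 1 + q * s ≠ 0 := by positivity
  have g5 : 1 + s * q ^ 2 ≠ 0 := by positivity
  field_simp
  ring

/-! ### Infinite q-shifted factorials, the weight and the function Φ -/

theorem multipliable_qFacInf (a : ℝ) {p : ℝ} (hp0 : 0 ≤ p) (hp1 : p < 1) :
    Multipliable fun j : ℕ => 1 - a * p ^ j := by
  have : Summable fun j : ℕ => -(a * p ^ j) :=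
    ((summable_geometric_of_lt_one hp0 hp1).mul_left a).neg
  simpa [sub_eq_add_neg] using Real.multipliable_one_add_of_summable this

theorem qFacInf_eq_mul (a : ℝ) {p : ℝ} (hp0 : 0 ≤ p) (hp1 : p < 1) :
    qFacInf a p = (1 - a) * qFacInf (a * p) p := by
  have hm : Multipliable fun j : ℕ => 1 - a * p ^ (j + 1) := by
    simpa only [pow_succ', mul_assoc] using multipliable_qFacInf (a * p) hp0 hp1
  have h := tprod_eq_zero_mul' (f := fun j : ℕ => 1 - a * p ^ j) hm
  rw [pow_zero, mul_one] at h
  simpa only [qFacInf, mul_assoc, ← pow_succ'] using h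

theorem qFacInf_pos {a p : ℝ} (ha : a ≤ 0) (hp0 : 0 ≤ p) (hp1 : p < 1) : 0 < qFacInf a p := by
  refine zero_lt_one.trans_le ?_
  refine ge_of_tendsto (multipliable_qFacInf a hp0 hp1).hasProd.tendsto_prod_nat
    (Filter.Eventually.of_forall fun n => ?_)
  induction n with
  | zero => simp
  | succ n ih =>
    rw [Finset.prod_range_succ]
    refine one_le_mul_of_one_le_of_one_le ih ?_
    linarith [mul_nonpos_of_nonpos_of_nonneg ha (pow_nonneg hp0 n)]

theorem qFacInt_pos {a p : ℝ} (ha : a ≤ 0) (hp0 : 0 ≤ p) (hp1 : p < 1) (l : ℤ) :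
    0 < qFacInt a p l :=
  div_pos (qFacInf_pos ha hp0 hp1)
    (qFacInf_pos (mul_nonpos_of_nonpos_of_nonneg ha (zpow_nonneg hp0 l)) hp0 hp1)

theorem qFacInt_add_one {a p : ℝ} (ha : a ≤ 0) (hp0 : 0 < p) (hp1 : p < 1) (l : ℤ) :
    qFacInt a p (l + 1) = qFacInt a p l * (1 - a * p ^ l) := by
  have hl := mul_nonpos_of_nonpos_of_nonneg ha (zpow_nonneg hp0.le l)
  have h2 := qFacInf_pos (mul_nonpos_of_nonpos_of_nonneg hl hp0.le) hp0.le hp1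
  have h3 : 1 - a * p ^ l ≠ 0 := by linarith
  rw [qFacInt, qFacInt, qFacInf_eq_mul (a * p ^ l) hp0.le hp1, zpow_add_one₀ hp0.ne',
    ← mul_assoc]
  field_simp

theorem ascWeight_pos {q α β : ℝ} (hq0 : 0 < q) (hq1 : q < 1) (hα : α ≠ 0) (hβ : 0 ≤ β) (l : ℤ) :
    0 < ascWeight q α β l := by
  have hp0 : 0 < q ^ 2 := by positivity
  have hp1 : q ^ 2 < 1 := by nlinarith
  have hα2 : 0 < α ^ 2 := by positivity
  have hq' := zpow_pos hq0 (2 * l)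
  rw [ascWeight]
  have e4 : 0 < α ^ (4 * l) := Even.zpow_pos (by rw [Int.even_mul]; left; decide) hα
  have e2 : 0 < α ^ (2 * l) := Even.zpow_pos (by simp) hα
  split_ifs with h
  · positivity
  · have hβ' : 0 < β := lt_of_le_of_ne hβ (Ne.symm h)
    have h1 := qFacInt_pos (a := -α ^ 2 / β) (by rw [neg_div]; have := div_pos hα2 hβ'; linarith)
      hp0.le hp1 l
    have h2 := qFacInt_pos (a := -α ^ 2 * β * q ^ 2)
      (by have : 0 < α ^ 2 * β * q ^ 2 := by positivity
          linarith) hp0.le hp1 l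
    positivity

/-- The weight is the symmetrizing measure of `L` (detailed balance). -/
theorem ascWeight_add_one {q α β : ℝ} (hq0 : 0 < q) (hq1 : q < 1) (hα : α ≠ 0) (hβ : 0 ≤ β)
    (l : ℤ) :
    ascWeight q α β (l + 1) * coefA q β ((α * q ^ (l + 1)) ^ 2) =
      ascWeight q α β l * coefB q β ((α * q ^ l) ^ 2) := by
  have hp0 : 0 < q ^ 2 := by positivity
  have hp1 : q ^ 2 < 1 := by nlinarith
  have hα2 : 0 < α ^ 2 := by positivity
  have hz := zpow_pos hq0 l
  have z2 : q ^ (2 * l) = (q ^ l) ^ 2 := by rw [mul_comm, zpow_mul]; norm_cast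
  have z2' : q ^ (2 * (l + 1)) = (q ^ l * q) ^ 2 := by
    rw [← zpow_add_one₀ hq0.ne', mul_comm, zpow_mul]; norm_cast
  have z1 : q ^ (l + 1) = q ^ l * q := zpow_add_one₀ hq0.ne' l
  have p2 : (q ^ 2) ^ l = (q ^ l) ^ 2 := by
    rw [← z2, zpow_mul]; norm_cast
  have a2 : α ^ (2 * (l + 1)) = α ^ (2 * l) * α ^ 2 := by
    rw [mul_add, zpow_add₀ hα]; norm_cast
  have a4 : α ^ (4 * (l + 1)) = α ^ (4 * l) * α ^ 4 := by
    rw [mul_add, zpow_add₀ hα]; norm_cast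
  have q1 : q ^ ((l + 1) ^ 2) = q ^ (l ^ 2) * (q ^ l) ^ 2 * q := by
    rw [← z2, ← zpow_add₀ hq0.ne', ← zpow_add_one₀ hq0.ne']; congr 1; ring
  have q2 : q ^ ((l + 1) * (2 * (l + 1) - 1)) = q ^ (l * (2 * l - 1)) * (q ^ l) ^ 4 * q := by
    have : (q ^ l) ^ 4 = q ^ (4 * l) := by rw [mul_comm, zpow_mul]; norm_cast
    rw [this, ← zpow_add₀ hq0.ne', ← zpow_add_one₀ hq0.ne']; congr 1; ring
  rw [ascWeight, ascWeight, coefA, coefB]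
  split_ifs with h
  · subst h
    rw [a4, q2, z2, z2', z1]
    generalize q ^ l = z at *
    field_simp
    ring
  · have hβ' : 0 < β := lt_of_le_of_ne hβ (Ne.symm h)
    have n1 : -α ^ 2 / β ≤ 0 := by rw [neg_div]; have := div_pos hα2 hβ'; linarith
    have n2 : -α ^ 2 * β * q ^ 2 ≤ 0 := by
      have : 0 < α ^ 2 * β * q ^ 2 := by positivity
      linarith
    have h2 := qFacInt_pos n2 hp0.le hp1 l
    rw [qFacInt_add_one n1 hp0 hp1, qFacInt_add_one n2 hp0 hp1, a2, q1, z2, z2', z1, p2,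
      zpow_add_one₀ h]
    generalize q ^ l = z at *
    generalize qFacInt (-α ^ 2 * β * q ^ 2) (q ^ 2) l = D at *
    have h3 : 1 - -α ^ 2 * β * q ^ 2 * z ^ 2 = 1 + β * (α * (z * q)) ^ 2 := by ring
    have h4 : 0 < 1 + β * (α * (z * q)) ^ 2 := by positivity
    rw [h3]
    field_simp
    ring

/-- `Φ` as a function of `v = e^{-y}`. -/
theorem ascPhi_eq (q β : ℝ) {v : ℝ} (hv : 0 < v) :
    ascPhi q β (dblX v / 2) =
      ((qFacInf (-v ^ 2 / β) (q ^ 2) / qFacInf (-v ^ 2 * β * q ^ 2) (q ^ 2) : ℝ) : ℂ) *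
        Complex.exp (Real.log v * ((Complex.I * Real.pi - Real.log β) / Real.log q - 1)) := by
  have hx : dblX v / 2 = Real.sinh (-Real.log v) := by
    rw [Real.sinh_eq, neg_neg, Real.exp_neg, Real.exp_log hv, dblX]
  have hexp : Real.exp (-2 * -Real.log v) = v ^ 2 := by
    rw [show -2 * -Real.log v = (2 : ℕ) * Real.log v by push_cast; ring, Real.exp_nat_mul,
      Real.exp_log hv]
  simp only [ascPhi]
  rw [hx, Real.arsinh_sinh, hexp]
  push_cast
  rw [neg_neg]

/-- Multiplication by `Φ` intertwines the off-diagonal part of `L` for the parameter `β` with that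
of `-β q L` for the parameter `1 / (β q²)`. -/
theorem coefA_mul_ascPhi {q β v : ℝ} (hq0 : 0 < q) (hq1 : q < 1) (hβ : 0 < β) (hv : 0 < v) :
    (coefA q β (v ^ 2) : ℂ) * ascPhi q β (dblX (v / q) / 2) =
      -(β * q) * coefA q (1 / (β * q ^ 2)) (v ^ 2) * ascPhi q β (dblX v / 2) := by
  have hp0 : 0 < q ^ 2 := by positivity
  have hp1 : q ^ 2 < 1 := by nlinarith
  rw [ascPhi_eq q β hv, ascPhi_eq q β (div_pos hv hq0)]
  have hlog : Real.log q ≠ 0 := (Real.log_neg hq0 hq1).ne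
  have hlog' : (Real.log q : ℂ) ≠ 0 := by exact_mod_cast hlog
  -- Dividing `v` by `q` multiplies the exponential by `e^{log β + log q - iπ} = -β q`.
  have hE : Complex.exp (Real.log (v / q) *
      ((Complex.I * Real.pi - Real.log β) / Real.log q - 1)) =
      -(β * q) * Complex.exp (Real.log v *
        ((Complex.I * Real.pi - Real.log β) / Real.log q - 1)) := by
    rw [Real.log_div hv.ne' hq0.ne']
    have : ((Real.log v - Real.log q : ℝ) : ℂ) *
        ((Complex.I * Real.pi - Real.log β) / Real.log q - 1) =
        Real.log β + Real.log q + -(Real.pi * Complex.I) +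
          Real.log v * ((Complex.I * Real.pi - Real.log β) / Real.log q - 1) := by
      push_cast
      field_simp
      ring
    rw [this, Complex.exp_add, Complex.exp_add, Complex.exp_add, ← Complex.ofReal_exp,
      ← Complex.ofReal_exp, Real.exp_log hβ, Real.exp_log hq0, Complex.exp_neg,
      Complex.exp_pi_mul_I]
    norm_num
  rw [hE]
  have n1 : -v ^ 2 / β ≤ 0 := by
    rw [neg_div]; have : 0 < v ^ 2 / β := by positivity
    linarith
  have n2 : -v ^ 2 * β ≤ 0 := by
    have : 0 < v ^ 2 * β := by positivity
    linarith
  have hD := qFacInf_pos (mul_nonpos_of_nonpos_of_nonneg n2 hp0.le) hp0.le hp1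
  have hN : qFacInf (-(v / q) ^ 2 / β) (q ^ 2) =
      (1 + v ^ 2 / (β * q ^ 2)) * qFacInf (-v ^ 2 / β) (q ^ 2) := by
    rw [qFacInf_eq_mul (-(v / q) ^ 2 / β) hp0.le hp1]
    congr 2
    · field_simp
      ring
    · field_simp
  have hD' : qFacInf (-(v / q) ^ 2 * β * q ^ 2) (q ^ 2) =
      (1 + β * v ^ 2) * qFacInf (-v ^ 2 * β * q ^ 2) (q ^ 2) := by
    have : -(v / q) ^ 2 * β * q ^ 2 = -v ^ 2 * β := by field_simp
    rw [this, qFacInf_eq_mul (-v ^ 2 * β) hp0.le hp1]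
    ring
  rw [hN, hD']
  generalize qFacInf (-v ^ 2 / β) (q ^ 2) = N at *
  generalize qFacInf (-v ^ 2 * β * q ^ 2) (q ^ 2) = D at *
  have key : coefA q β (v ^ 2) * ((1 + v ^ 2 / (β * q ^ 2)) * N / ((1 + β * v ^ 2) * D)) =
      coefA q (1 / (β * q ^ 2)) (v ^ 2) * (N / D) := by
    rw [coefA, coefA]
    have : 1 + β * v ^ 2 ≠ 0 := by positivity
    field_simp
  have key' : (coefA q β (v ^ 2) : ℂ) *
      (((1 + v ^ 2 / (β * q ^ 2)) * N / ((1 + β * v ^ 2) * D) : ℝ) : ℂ) =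
      coefA q (1 / (β * q ^ 2)) (v ^ 2) * ((N / D : ℝ) : ℂ) := by
    exact_mod_cast key
  linear_combination (-(β * q) * Complex.exp (Real.log v *
        ((Complex.I * Real.pi - Real.log β) / Real.log q - 1))) * key'

theorem coefB_mul_ascPhi {q β v : ℝ} (hq0 : 0 < q) (hq1 : q < 1) (hβ : 0 < β) (hv : 0 < v) :
    (coefB q β (v ^ 2) : ℂ) * ascPhi q β (dblX (v * q) / 2) =
      -(β * q) * coefB q (1 / (β * q ^ 2)) (v ^ 2) * ascPhi q β (dblX v / 2) := by
  have h := coefA_mul_ascPhi hq0 hq1 hβ (mul_pos hv hq0)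
  rw [mul_div_cancel_right₀ _ hq0.ne'] at h
  have key : coefB q β (v ^ 2) * coefA q β ((v * q) ^ 2) = (β * q) ^ 2 *
      (coefB q (1 / (β * q ^ 2)) (v ^ 2) * coefA q (1 / (β * q ^ 2)) ((v * q) ^ 2)) := by
    simp only [coefA, coefB]
    field_simp
    ring
  have key' : (coefB q β (v ^ 2) : ℂ) * coefA q β ((v * q) ^ 2) = (β * q) ^ 2 *
      (coefB q (1 / (β * q ^ 2)) (v ^ 2) * coefA q (1 / (β * q ^ 2)) ((v * q) ^ 2)) := by
    exact_mod_cast key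
  have hA : (-(β * q) * coefA q (1 / (β * q ^ 2)) ((v * q) ^ 2) : ℂ) ≠ 0 := by
    have h1 := coefA_pos (β := 1 / (β * q ^ 2)) (s := (v * q) ^ 2) hq0 (by positivity)
      (by positivity)
    exact_mod_cast (mul_neg_of_neg_of_pos (by nlinarith : -(β * q) < 0) h1).ne
  -- The relation for `A` at `v q` inverts to the one for `B` at `v`.
  refine mul_left_cancel₀ hA ?_
  linear_combination ascPhi q β (dblX v / 2) * key' - coefB q β (v ^ 2) * h

theorem coefC_dual {q β s : ℝ} (hq0 : 0 < q) (hβ : 0 < β) :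
    coefC q β s = -(β * q) * coefC q (1 / (β * q ^ 2)) s := by
  rw [coefC, coefC]
  field_simp
  ring

/-! ### The operator on the grid -/

/-- The value of `s` at the grid point `x_l(α)`. -/
def gridSq (q α : ℝ) (l : ℤ) : ℝ := (α * q ^ l) ^ 2

theorem gridSq_pos {q α : ℝ} (hq : 0 < q) (hα : α ≠ 0) (l : ℤ) : 0 < gridSq q α l := by
  have := zpow_pos hq l
  rw [gridSq]
  positivity

theorem gridSq_add_one {q : ℝ} (α : ℝ) (hq : 0 < q) (l : ℤ) :
    gridSq q α (l + 1) = gridSq q α l * q ^ 2 := by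
  rw [gridSq, gridSq, zpow_add_one₀ hq.ne']
  ring

theorem gridSq_natCast (q α : ℝ) (n : ℕ) : gridSq q α n = α ^ 2 * (q ^ 2) ^ n := by
  rw [gridSq, zpow_natCast]
  ring

theorem inv_gridSq_neg_natCast (q α : ℝ) (n : ℕ) :
    (gridSq q α (-(n : ℤ)))⁻¹ = (α ^ 2)⁻¹ * (q ^ 2) ^ n := by
  rw [gridSq, zpow_neg, zpow_natCast, mul_pow, mul_inv, inv_pow, inv_inv]
  ring

theorem gridPoint_eq (q α : ℝ) (l : ℤ) : gridPoint q α l = dblX (α * q ^ l) / 2 := by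
  rw [gridPoint, dblX, one_div]

theorem gridPoint_add_one {q : ℝ} (α : ℝ) (hq : 0 < q) (l : ℤ) :
    gridPoint q α (l + 1) = dblX (α * q ^ l * q) / 2 := by
  rw [gridPoint_eq, zpow_add_one₀ hq.ne', mul_assoc]

theorem gridPoint_sub_one {q : ℝ} (α : ℝ) (hq : 0 < q) (l : ℤ) :
    gridPoint q α (l - 1) = dblX (α * q ^ l / q) / 2 := by
  rw [gridPoint_eq, zpow_sub_one₀ hq.ne', div_eq_mul_inv (_ * _), mul_assoc]

theorem gridPoint_injective {q α : ℝ} (hq0 : 0 < q) (hq1 : q < 1) (hα : α ≠ 0) :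
    Function.Injective (gridPoint q α) := by
  intro l m h
  have h1 := zpow_pos hq0 l
  have h2 := zpow_pos hq0 m
  have h3 : (q ^ l - q ^ m) * (1 + α ^ 2 * (q ^ l * q ^ m)) = 0 := by
    rw [gridPoint, gridPoint] at h
    field_simp at h
    linear_combination -h
  have h4 : 1 + α ^ 2 * (q ^ l * q ^ m) ≠ 0 := by positivity
  have h5 := (mul_eq_zero.1 h3).resolve_right h4
  exact zpow_right_injective₀ hq0 hq1.ne (sub_eq_zero.1 h5)

/-- On the grid, `f` satisfies `L f = c f`. -/
def IsGridEigen (q α β : ℝ) (f : ℝ → ℂ) (c : ℝ) : Prop :=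
  ∀ l : ℤ, coefA q β (gridSq q α l) * f (gridPoint q α (l - 1)) +
    coefC q β (gridSq q α l) * f (gridPoint q α l) +
    coefB q β (gridSq q α l) * f (gridPoint q α (l + 1)) = c * f (gridPoint q α l)

theorem isGridEigen_ascFun {q α : ℝ} (β : ℝ) (hq : 0 < q) (hα : α ≠ 0) (n : ℕ) :
    IsGridEigen q α β (ascFun q β n) (q ^ n) := by
  intro l
  have hu : α * q ^ l ≠ 0 := mul_ne_zero hα (zpow_ne_zero _ hq.ne')
  have h := symASC_eigen β hq hu n
  rw [← gridPoint_sub_one α hq, ← gridPoint_add_one α hq, ← gridPoint_eq] at h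
  simp only [ascFun, gridSq]
  exact_mod_cast h

/-- The intertwining relations of `Φ` on the grid. For `α < 0` one has `e^{-y} = -1 / (α q^l)` at
`x_l(α)`, so that the two relations trade places. -/
theorem ascPhi_gridPoint {q α β : ℝ} (hq0 : 0 < q) (hq1 : q < 1) (hα : α ≠ 0) (hβ : 0 < β)
    (l : ℤ) :
    (coefA q β (gridSq q α l) : ℂ) * ascPhi q β (gridPoint q α (l - 1)) =
      -(β * q) * coefA q (1 / (β * q ^ 2)) (gridSq q α l) * ascPhi q β (gridPoint q α l) ∧
    (coefB q β (gridSq q α l) : ℂ) * ascPhi q β (gridPoint q α (l + 1)) =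
      -(β * q) * coefB q (1 / (β * q ^ 2)) (gridSq q α l) * ascPhi q β (gridPoint q α l) := by
  rw [gridPoint_sub_one α hq0, gridPoint_add_one α hq0, gridPoint_eq, gridSq]
  have hz := zpow_pos hq0 l
  rcases lt_or_gt_of_ne hα with h | h
  · have hu : α * q ^ l < 0 := mul_neg_of_neg_of_pos h hz
    generalize α * q ^ l = u at *
    have hv : 0 < (-u)⁻¹ := inv_pos.2 (by linarith)
    have hu' := hu.ne
    have e0 : dblX u = dblX (-u)⁻¹ := by rw [dblX, dblX, inv_inv, inv_neg]; ring
    have e1 : dblX (u / q) = dblX ((-u)⁻¹ * q) := by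
      rw [dblX, dblX]; field_simp; ring
    have e2 : dblX (u * q) = dblX ((-u)⁻¹ / q) := by
      rw [dblX, dblX]; field_simp; ring
    have hs : u ^ 2 = (((-u)⁻¹) ^ 2)⁻¹ := by rw [inv_pow, inv_inv, neg_sq]
    have hv2 : 0 < ((-u)⁻¹) ^ 2 := by positivity
    have hB : ∀ b, coefB q b (u ^ 2) = coefA q b (((-u)⁻¹) ^ 2) := by
      intro b
      rw [← coefA_inv b hq0 (by positivity), hs, inv_inv]
    have hA : ∀ b, coefA q b (u ^ 2) = coefB q b (((-u)⁻¹) ^ 2) := by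
      intro b
      rw [hs, coefA_inv b hq0 hv2]
    rw [e0, e1, e2, hA, hA, hB, hB]
    exact ⟨coefB_mul_ascPhi hq0 hq1 hβ hv, coefA_mul_ascPhi hq0 hq1 hβ hv⟩
  · exact ⟨coefA_mul_ascPhi hq0 hq1 hβ (mul_pos h hz), coefB_mul_ascPhi hq0 hq1 hβ (mul_pos h hz)⟩

theorem isGridEigen_ascDualFun {q α β : ℝ} (hq0 : 0 < q) (hq1 : q < 1) (hα : α ≠ 0) (hβ : 0 < β)
    (n : ℕ) : IsGridEigen q α β (ascDualFun q β n) (-(β * q) * q ^ n) := by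
  intro l
  obtain ⟨hA, hB⟩ := ascPhi_gridPoint hq0 hq1 hα hβ l
  have hC : (coefC q β (gridSq q α l) : ℂ) =
      -(β * q) * coefC q (1 / (β * q ^ 2)) (gridSq q α l) := by
    exact_mod_cast coefC_dual hq0 hβ
  have h := isGridEigen_ascFun (α := α) (1 / (β * q ^ 2)) hq0 hα n l
  simp only [ascDualFun]
  rw [hC]
  push_cast at h ⊢
  linear_combination ascFun q (1 / (β * q ^ 2)) n (gridPoint q α (l - 1)) * hA +
    ascFun q (1 / (β * q ^ 2)) n (gridPoint q α (l + 1)) * hB -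
    β * q * ascPhi q β (gridPoint q α l) * h

theorem ascWeight_gridSq {q α β : ℝ} (hq0 : 0 < q) (hq1 : q < 1) (hα : α ≠ 0) (hβ : 0 ≤ β)
    (l : ℤ) :
    ascWeight q α β (l + 1) * coefA q β (gridSq q α (l + 1)) =
      ascWeight q α β l * coefB q β (gridSq q α l) :=
  ascWeight_add_one hq0 hq1 hα hβ l

/-- Two functions on `ℤ` with the same successive ratios are proportional. -/
theorem eq_div_mul_of_ratio {F G : ℤ → ℝ} (hG : ∀ l, 0 < G l)
    (h : ∀ l, F (l + 1) * G l = F l * G (l + 1)) (l : ℤ) : F l = F 0 / G 0 * G l := by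
  have key : ∀ l, F (l + 1) / G (l + 1) = F l / G l := fun l =>
    (div_eq_div_iff (hG _).ne' (hG _).ne').2 (h l)
  have : F l / G l = F 0 / G 0 := by
    induction l using Int.induction_on with
    | zero => rfl
    | succ i ih => rw [key, ih]
    | pred i ih => rw [← ih, ← key (-(i : ℤ) - 1), sub_add_cancel]
  rw [← this, div_mul_cancel₀ _ (hG l).ne']

/-- `|Φ|²` times the weight is proportional to the weight for the dual parameter `1 / (β q²)`. -/
theorem exists_ascWeight_mul_ascPhi_sq {q α β : ℝ} (hq0 : 0 < q) (hq1 : q < 1) (hα : α ≠ 0)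
    (hβ : 0 < β) :
    ∃ c : ℝ, ∀ l, ascWeight q α β l * ‖ascPhi q β (gridPoint q α l)‖ ^ 2 =
      c * ascWeight q α (1 / (β * q ^ 2)) l := by
  have hβ' : 0 ≤ 1 / (β * q ^ 2) := by positivity
  refine ⟨_, eq_div_mul_of_ratio (fun l => ascWeight_pos hq0 hq1 hα hβ' l) fun l => ?_⟩
  have hA := congrArg norm (ascPhi_gridPoint hq0 hq1 hα hβ (l + 1)).1
  have hB := congrArg norm (ascPhi_gridPoint hq0 hq1 hα hβ l).2
  have s0 := gridSq_pos hq0 hα l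
  have s1 := gridSq_pos hq0 hα (l + 1)
  rw [add_sub_cancel_right] at hA
  have hneg : (-((β : ℂ) * q)) = ((-(β * q) : ℝ) : ℂ) := by push_cast; ring
  have hbq : 0 < β * q := by positivity
  rw [hneg] at hA hB
  simp only [norm_mul, Complex.norm_real, Real.norm_eq_abs, abs_neg, abs_of_pos hbq,
    abs_of_pos (coefA_pos hq0 hβ.le s1), abs_of_pos (coefB_pos hq0 hβ.le s0),
    abs_of_pos (coefA_pos hq0 hβ' s1), abs_of_pos (coefB_pos hq0 hβ' s0)] at hA hB
  have h1 := ascWeight_gridSq hq0 hq1 hα hβ.le l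
  have h2 := ascWeight_gridSq hq0 hq1 hα hβ' l
  have hA' := coefA_pos hq0 hβ' s1
  generalize ‖ascPhi q β (gridPoint q α (l + 1))‖ = f1 at *
  generalize ‖ascPhi q β (gridPoint q α l)‖ = f0 at *
  refine mul_left_cancel₀ (mul_pos hbq hA').ne' ?_
  linear_combination (-f1 * ascWeight q α (1 / (β * q ^ 2)) l * ascWeight q α β (l + 1)) * hA +
    f0 * f1 * ascWeight q α (1 / (β * q ^ 2)) l * h1 +
    f0 * ascWeight q α (1 / (β * q ^ 2)) l * ascWeight q α β l * hB -
    f0 ^ 2 * ascWeight q α β l * (β * q) * h2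

/-! ### Finiteness of the moments -/

/-- A ratio test covering both ends of the grid: the ratio `K B(s) / A(q² s)` tends to `0` as
`s → 0`, and `s ↦ 1 / s` exchanges `A` and `B`. -/
theorem summable_of_ratio_coef {q β a K : ℝ} (hq0 : 0 < q) (hq1 : q < 1) (hβ : 0 ≤ β) (ha : 0 < a)
    {f : ℕ → ℝ} (hf : ∀ n, 0 < f n)
    (h : ∀ n, f (n + 1) * coefA q β (a * (q ^ 2) ^ (n + 1)) =
      K * (f n * coefB q β (a * (q ^ 2) ^ n))) : Summable f := by
  have ht : Filter.Tendsto (fun n : ℕ => a * (q ^ 2) ^ n) Filter.atTop (nhds 0) := by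
    simpa using (tendsto_pow_atTop_nhds_zero_of_lt_one (by positivity)
      (by nlinarith : q ^ 2 < 1)).const_mul a
  have hlim : Filter.Tendsto
      (fun s : ℝ => K * (coefB q β s / coefA q β (s * q ^ 2))) (nhds 0) (nhds 0) := by
    have : ContinuousAt (fun s : ℝ => K * (coefB q β s / coefA q β (s * q ^ 2))) 0 := by
      simp only [coefA, coefB]
      fun_prop (disch := simp [hq0.ne'])
    simpa [ContinuousAt, coefB] using this
  refine summable_of_ratio_test_tendsto_lt_one zero_lt_one
    (Filter.Eventually.of_forall fun n => (hf n).ne') ((hlim.comp ht).congr fun n => ?_)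
  have hA := coefA_pos (s := a * (q ^ 2) ^ (n + 1)) hq0 hβ (by positivity)
  have hfn := hf n
  rw [Real.norm_of_nonneg (hf _).le, Real.norm_of_nonneg (hf _).le, Function.comp_apply, mul_assoc,
    ← pow_succ, ← mul_div_assoc, div_eq_div_iff hA.ne' hfn.ne']
  linear_combination -h n

theorem summable_ascWeight_mul_zpow {q α β : ℝ} (hq0 : 0 < q) (hq1 : q < 1) (hα : α ≠ 0)
    (hβ : 0 ≤ β) (k : ℤ) : Summable fun l : ℤ => ascWeight q α β l * gridSq q α l ^ k := by
  have hα2 : 0 < α ^ 2 := by positivity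
  have hw := ascWeight_pos hq0 hq1 hα hβ
  have hs := fun l => gridSq_pos (q := q) (α := α) hq0 hα l
  refine Summable.of_nat_of_neg ?_ ?_
  · refine summable_of_ratio_coef (K := (q ^ 2) ^ k) hq0 hq1 hβ hα2
      (fun n => mul_pos (hw _) (zpow_pos (hs _) k)) fun n => ?_
    have h := ascWeight_gridSq hq0 hq1 hα hβ n
    rw [← gridSq_natCast, ← gridSq_natCast, Nat.cast_succ]
    have e : gridSq q α (n + 1) ^ k = gridSq q α n ^ k * (q ^ 2) ^ k := by
      rw [gridSq_add_one α hq0, mul_zpow]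
    rw [e]
    linear_combination gridSq q α n ^ k * (q ^ 2) ^ k * h
  · refine summable_of_ratio_coef (K := ((q ^ 2) ^ k)⁻¹) hq0 hq1 hβ (inv_pos.2 hα2)
      (fun n => mul_pos (hw _) (zpow_pos (hs _) k)) fun n => ?_
    rw [← inv_gridSq_neg_natCast, ← inv_gridSq_neg_natCast, coefA_inv β hq0 (hs _),
      ← coefA_inv β hq0 (inv_pos.2 (hs _)), inv_inv]
    have e : (-(n : ℤ)) = -((n + 1 : ℕ) : ℤ) + 1 := by push_cast; ring
    rw [e]
    generalize -((n + 1 : ℕ) : ℤ) = m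
    have h := ascWeight_gridSq hq0 hq1 hα hβ m
    have hp : (q ^ 2) ^ k ≠ 0 := by positivity
    have e2 : gridSq q α (m + 1) ^ k = gridSq q α m ^ k * (q ^ 2) ^ k := by
      rw [gridSq_add_one α hq0, mul_zpow]
    rw [e2]
    field_simp
    linear_combination -gridSq q α m ^ k * h

theorem summable_ascWeight {q α β : ℝ} (hq0 : 0 < q) (hq1 : q < 1) (hα : α ≠ 0) (hβ : 0 ≤ β) :
    Summable (ascWeight q α β) := by
  simpa using summable_ascWeight_mul_zpow hq0 hq1 hα hβ 0

theorem summable_ascWeight_mul_pow {q α β : ℝ} (hq0 : 0 < q) (hq1 : q < 1) (hα : α ≠ 0)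
    (hβ : 0 ≤ β) (n : ℕ) :
    Summable fun l : ℤ => ascWeight q α β l * (gridPoint q α l ^ n) ^ 2 := by
  have hw := ascWeight_pos hq0 hq1 hα hβ
  have h1 := summable_ascWeight_mul_zpow hq0 hq1 hα hβ n
  have h2 := summable_ascWeight_mul_zpow hq0 hq1 hα hβ (-n)
  refine Summable.of_nonneg_of_le (fun l => mul_nonneg (hw l).le (sq_nonneg _)) (fun l => ?_)
    (h1.add h2)
  rw [← mul_add]
  refine mul_le_mul_of_nonneg_left ?_ (hw l).le
  have hs := gridSq_pos hq0 hα l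
  have hx : gridPoint q α l ^ 2 = ((gridSq q α l)⁻¹ - 2 + gridSq q α l) / 4 := by
    have hz := zpow_pos hq0 l
    rw [gridPoint, gridSq]
    field_simp
    ring
  rw [zpow_neg, zpow_natCast, ← pow_mul, mul_comm n 2, pow_mul, hx, ← inv_pow]
  have hi := inv_pos.2 hs
  generalize gridSq q α l = s at *
  generalize s⁻¹ = t at *
  have h0 : 0 ≤ (t - 2 + s) / 4 := by rw [← hx]; positivity
  rcases le_total s t with h | h
  · have : (t - 2 + s) / 4 ≤ t := by linarith
    have := pow_le_pow_left₀ h0 this n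
    have := pow_pos hs n
    linarith
  · have : (t - 2 + s) / 4 ≤ s := by linarith
    have := pow_le_pow_left₀ h0 this n
    have := pow_pos hi n
    linarith

/-! ### Eigenvectors of Hilbert--Schmidt Jacobi matrices -/

section Hilbert

variable {H : Type*} [NormedAddCommGroup H] [InnerProductSpace ℂ H]

theorem HilbertBasis.hasSum_norm_inner_sq {ι : Type*} (b : HilbertBasis ι ℂ H) (x : H) :
    HasSum (fun l => ‖inner ℂ (b l) x‖ ^ 2) (‖x‖ ^ 2) := by
  have h := Complex.hasSum_re (b.hasSum_inner_mul_inner x x)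
  rw [inner_self_eq_norm_sq_to_K] at h
  have e : ∀ l, (inner ℂ x (b l) * inner ℂ (b l) x).re = ‖inner ℂ (b l) x‖ ^ 2 := by
    intro l
    rw [← inner_conj_symm x (b l), ← Complex.normSq_eq_conj_mul_self, Complex.ofReal_re,
      Complex.normSq_eq_norm_sq]
  simp only [e] at h
  convert h using 1
  norm_cast

/-- If the columns `y l` of a matrix have total squared norm equal to the sum of the squares of the
eigenvalues of an orthonormal family of eigenvectors, then every vector orthogonal to these
eigenvectors is orthogonal to all columns: equality must hold in Bessel's inequality. -/
theorem inner_eq_zero_of_hilbertSchmidt {ι κ : Type*} (b : HilbertBasis ι ℂ H) {e : κ → H}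
    (he : Orthonormal ℂ e) {y : ι → H} {ev : κ → ℝ}
    (hy : ∀ n l, inner ℂ (y l) (e n) = ev n * inner ℂ (b l) (e n)) {S : ℝ}
    (hS : HasSum (fun l => ‖y l‖ ^ 2) S) (hev : HasSum (fun n => ev n ^ 2) S)
    {v : H} (hv : ∀ n, inner ℂ (e n) v = 0) (l : ι) : inner ℂ (y l) v = 0 := by
  rcases eq_or_ne v 0 with rfl | hv0
  · simp
  have hvn : ‖v‖ ≠ 0 := norm_ne_zero_iff.2 hv0
  have ha : ∀ n l, ‖inner ℂ (e n) (y l)‖ ^ 2 = ev n ^ 2 * ‖inner ℂ (b l) (e n)‖ ^ 2 := by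
    intro n l
    rw [norm_inner_symm, hy, norm_mul, mul_pow, Complex.norm_real, Real.norm_eq_abs, sq_abs]
  have hrow : ∀ n, HasSum (fun l => ‖inner ℂ (e n) (y l)‖ ^ 2) (ev n ^ 2) := by
    intro n
    simp only [ha]
    simpa [he.1 n] using (b.hasSum_norm_inner_sq (e n)).mul_left (ev n ^ 2)
  have hsum : Summable fun p : κ × ι => ‖inner ℂ (e p.1) (y p.2)‖ ^ 2 := by
    rw [summable_prod_of_nonneg fun p => by positivity]
    exact ⟨fun n => (hrow n).summable, by simpa only [(hrow _).tsum_eq] using hev.summable⟩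
  have hcol : HasSum (fun l => ∑' n, ‖inner ℂ (e n) (y l)‖ ^ 2) S := by
    have h1 : HasSum (fun p : κ × ι => ‖inner ℂ (e p.1) (y p.2)‖ ^ 2) S := by
      have := hsum.hasSum
      rwa [(this.prod_fiberwise hrow).unique hev] at this
    exact ((Equiv.prodComm ι κ).hasSum_iff.2 h1).prod_fiberwise
      fun l => (he.inner_products_summable (y l)).hasSum
  have hbes : ∀ l, ‖inner ℂ v (y l)‖ ^ 2 / ‖v‖ ^ 2 ≤
      ‖y l‖ ^ 2 - ∑' n, ‖inner ℂ (e n) (y l)‖ ^ 2 := by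
    intro l
    have hvv : inner ℂ v v = (‖v‖ : ℂ) ^ 2 := inner_self_eq_norm_sq_to_K v
    have hvc : (‖v‖ : ℂ) ≠ 0 := by exact_mod_cast hvn
    -- Bessel's inequality for the component of `y l` orthogonal to `v`.
    set t : ℂ := inner ℂ v (y l) / (‖v‖ : ℂ) ^ 2 with ht
    have h1 : ∀ n, inner ℂ (e n) (y l - t • v) = inner ℂ (e n) (y l) := by
      intro n
      rw [inner_sub_right, inner_smul_right, hv n, mul_zero, sub_zero]
    have h2 := he.tsum_inner_products_le (y l - t • v)
    simp only [h1] at h2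
    have horth : inner ℂ (y l - t • v) (t • v) = 0 := by
      rw [inner_smul_right, inner_sub_left, inner_smul_left, hvv, ← inner_conj_symm (y l) v, ht,
        map_div₀, map_pow, Complex.conj_ofReal]
      field_simp
      ring
    have h3 := norm_add_sq_eq_norm_sq_add_norm_sq_of_inner_eq_zero _ _ horth
    rw [sub_add_cancel] at h3
    have h4 : ‖t • v‖ * ‖t • v‖ = ‖inner ℂ v (y l)‖ ^ 2 / ‖v‖ ^ 2 := by
      rw [norm_smul, ht, norm_div, norm_pow, Complex.norm_real, norm_norm]
      field_simp
    rw [← h4, sq ‖y l‖, h3]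
    linarith
  have hzero := (hasSum_zero_iff_of_nonneg fun l => (by positivity :
    (0 : ℝ) ≤ ‖inner ℂ v (y l)‖ ^ 2 / ‖v‖ ^ 2).trans (hbes l)).1
    (by simpa using hS.sub hcol)
  have h5 := hbes l
  have h6 := congrFun hzero l
  simp only [Pi.zero_apply] at h6
  rw [h6, div_le_iff₀ (by positivity), zero_mul] at h5
  have h7 : ‖inner ℂ v (y l)‖ = 0 := by
    have := sq_nonneg ‖inner ℂ v (y l)‖
    exact pow_eq_zero_iff two_ne_zero |>.1 (le_antisymm h5 this)
  rw [norm_inner_symm] at h7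
  exact norm_eq_zero.1 h7

/-- The vector `e` satisfies the eigenvalue equation, with eigenvalue `t`, of the Jacobi matrix with
diagonal `c` and off-diagonal `j` in the basis `b`. -/
def IsJacobiEigen (b : HilbertBasis ℤ ℂ H) (j c : ℤ → ℝ) (e : H) (t : ℝ) : Prop :=
  ∀ l, j l * inner ℂ (b (l - 1)) e + c l * inner ℂ (b l) e + j (l + 1) * inner ℂ (b (l + 1)) e =
    t * inner ℂ (b l) e

/-- Eigenvectors for distinct eigenvalues are orthogonal: the sum of the products of their
coordinates is a telescoping sum of Wronskians. -/
theorem IsJacobiEigen.inner_eq_zero {b : HilbertBasis ℤ ℂ H} {j c : ℤ → ℝ} {J : ℝ}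
    (hj : ∀ l, |j l| ≤ J) {e f : H} {t u : ℝ} (he : IsJacobiEigen b j c e t)
    (hf : IsJacobiEigen b j c f u) (htu : t ≠ u) : inner ℂ e f = 0 := by
  set D : ℤ → ℂ := fun l => j l * (inner ℂ e (b l) * inner ℂ (b (l - 1)) f -
    inner ℂ e (b (l - 1)) * inner ℂ (b l) f) with hD
  have hstep : ∀ l, D l - D (l + 1) = (u - t) * (inner ℂ e (b l) * inner ℂ (b l) f) := by
    intro l
    have h1 := congrArg conj (he l)
    simp only [map_add, map_mul, Complex.conj_ofReal, inner_conj_symm] at h1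
    have h2 := hf l
    simp only [hD, add_sub_cancel_right]
    linear_combination inner ℂ e (b l) * h2 - inner ℂ (b l) f * h1
  have hJ : 0 ≤ J := (abs_nonneg _).trans (hj 0)
  have se := (b.hasSum_norm_inner_sq e).summable
  have sf := (b.hasSum_norm_inner_sq f).summable
  have se' := (Equiv.subRight (1 : ℤ)).summable_iff.2 se
  have sf' := (Equiv.subRight (1 : ℤ)).summable_iff.2 sf
  have hDs : Summable D := by
    refine Summable.of_norm_bounded (((se.add sf').add (se'.add sf)).mul_left J) fun l => ?_
    simp only [hD, norm_mul, Complex.norm_real, Real.norm_eq_abs, Function.comp_apply,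
      Equiv.subRight_apply]
    refine mul_le_mul (hj l) ((norm_sub_le _ _).trans ?_) (norm_nonneg _) hJ
    rw [norm_mul, norm_mul, norm_inner_symm e, norm_inner_symm e]
    generalize ‖inner ℂ (b l) e‖ = x
    generalize ‖inner ℂ (b (l - 1)) e‖ = x'
    generalize ‖inner ℂ (b l) f‖ = z
    generalize ‖inner ℂ (b (l - 1)) f‖ = z'
    nlinarith [sq_nonneg (x - z'), sq_nonneg (x' - z), sq_nonneg x, sq_nonneg x', sq_nonneg z,
      sq_nonneg z']
  have h0 : HasSum (fun l => D l - D (l + 1)) 0 := by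
    simpa using hDs.hasSum.sub ((Equiv.addRight (1 : ℤ)).hasSum_iff.2 hDs.hasSum)
  simp only [hstep] at h0
  have h1 := ((b.hasSum_inner_mul_inner e f).mul_left ((u : ℂ) - t)).unique h0
  refine (mul_eq_zero.1 h1).resolve_left ?_
  rw [sub_eq_zero]
  exact_mod_cast htu.symm

/-- Completeness criterion for eigenvectors of a Hilbert--Schmidt Jacobi matrix with trivial
kernel: the squares of the eigenvalues add up to the square of the Hilbert--Schmidt norm. -/
theorem IsJacobiEigen.eq_zero_of_orthogonal {κ : Type*} {b : HilbertBasis ℤ ℂ H} {j c : ℤ → ℝ}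
    {e : κ → H} {ev : κ → ℝ} (he0 : ∀ n, e n ≠ 0) (he : ∀ n, IsJacobiEigen b j c (e n) (ev n))
    (horth : Pairwise fun m n => inner ℂ (e m) (e n) = 0) {S : ℝ}
    (hS : HasSum (fun l => j l ^ 2 + c l ^ 2 + j (l + 1) ^ 2) S)
    (hev : HasSum (fun n => ev n ^ 2) S)
    (hker : ∀ v, IsJacobiEigen b j c v 0 → v = 0)
    {v : H} (hv : ∀ n, inner ℂ (e n) v = 0) : v = 0 := by
  set y : ℤ → H := fun l =>
    (j l : ℂ) • b (l - 1) + (c l : ℂ) • b l + (j (l + 1) : ℂ) • b (l + 1) with hy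
  have hin : ∀ l x, inner ℂ (y l) x = j l * inner ℂ (b (l - 1)) x + c l * inner ℂ (b l) x +
      j (l + 1) * inner ℂ (b (l + 1)) x := by
    intro l x
    simp only [hy, inner_add_left, inner_smul_left, Complex.conj_ofReal]
  have hnorm : ∀ l, ‖y l‖ ^ 2 = j l ^ 2 + c l ^ 2 + j (l + 1) ^ 2 := by
    intro l
    have o := orthonormal_iff_ite.1 b.orthonormal
    have h1 : inner ℂ (y l) (y l) =
        ((j l ^ 2 + c l ^ 2 + j (l + 1) ^ 2 : ℝ) : ℂ) := by
      rw [hin]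
      simp only [hy, inner_add_right, inner_smul_right, o]
      have n1 : l ≠ l + 1 := by omega
      have n2 : l - 1 ≠ l := by omega
      have n3 : l - 1 ≠ l + 1 := by omega
      simp only [n1, n2, n3, n1.symm, n2.symm, n3.symm, if_true, if_false]
      push_cast
      ring
    rw [inner_self_eq_norm_sq_to_K] at h1
    have h2 : ((‖y l‖ ^ 2 : ℝ) : ℂ) = ((j l ^ 2 + c l ^ 2 + j (l + 1) ^ 2 : ℝ) : ℂ) := by
      rw [← h1]
      push_cast
      rfl
    exact Complex.ofReal_injective h2
  have hunit : Orthonormal ℂ fun n => ((‖e n‖⁻¹ : ℝ) : ℂ) • e n := by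
    refine ⟨fun n => ?_, fun m n hmn => ?_⟩
    · have := norm_ne_zero_iff.2 (he0 n)
      rw [norm_smul, Complex.norm_real, norm_inv, norm_norm, inv_mul_cancel₀ this]
    · simp only [inner_smul_left, inner_smul_right, horth hmn, mul_zero]
  refine hker v fun l => ?_
  have h := inner_eq_zero_of_hilbertSchmidt b hunit (y := y) (ev := ev) ?_
    (by simpa only [hnorm] using hS) hev (v := v) ?_ l
  · rw [← hin, h]; simp
  · intro n l
    rw [inner_smul_right, inner_smul_right, hin, he n l]
    ring
  · intro n
    rw [inner_smul_left, hv n, mul_zero]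

end Hilbert

/-! ### The symmetrized matrix of L -/

/-- The off-diagonal entry between `l - 1` and `l` of the symmetrized matrix of `L`. -/
def offDiag (q α β : ℝ) (l : ℤ) : ℝ :=
  √(coefA q β (gridSq q α l) * coefB q β (gridSq q α (l - 1)))

/-- The diagonal entry at `l` of the matrix of `L`. -/
def onDiag (q α β : ℝ) (l : ℤ) : ℝ := coefC q β (gridSq q α l)

theorem gridSq_sub_one {q : ℝ} (α : ℝ) (hq : 0 < q) (l : ℤ) :
    gridSq q α (l - 1) = gridSq q α l / q ^ 2 := by
  rw [eq_div_iff (by positivity), ← gridSq_add_one α hq, sub_add_cancel]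

section

variable {q α β : ℝ}

theorem offDiag_pos (hq : 0 < q) (hα : α ≠ 0) (hβ : 0 ≤ β) (l : ℤ) : 0 < offDiag q α β l :=
  Real.sqrt_pos.2 (mul_pos (coefA_pos hq hβ (gridSq_pos hq hα _))
    (coefB_pos hq hβ (gridSq_pos hq hα _)))

theorem offDiag_sq (hq : 0 < q) (hα : α ≠ 0) (hβ : 0 ≤ β) (l : ℤ) :
    offDiag q α β l ^ 2 = coefA q β (gridSq q α l) * coefB q β (gridSq q α l / q ^ 2) := by
  rw [offDiag, gridSq_sub_one α hq, Real.sq_sqrt]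
  have hs := gridSq_pos hq hα l
  exact (mul_pos (coefA_pos hq hβ hs) (coefB_pos hq hβ (by positivity))).le

/-- The sum over `ℤ` of the increments of a monotone function with limits at `±∞`. -/
theorem hasSum_int_telescope {F : ℤ → ℝ} {a b : ℝ} (hF : ∀ l, F l ≤ F (l + 1))
    (ha : Filter.Tendsto (fun n : ℕ => F n) Filter.atTop (nhds a))
    (hb : Filter.Tendsto (fun n : ℕ => F (-(n : ℤ))) Filter.atTop (nhds b)) :
    HasSum (fun l => F (l + 1) - F l) (a - b) := by
  have h1 : HasSum (fun n : ℕ => F ((n : ℤ) + 1) - F n) (a - F 0) := by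
    rw [hasSum_iff_tendsto_nat_of_nonneg fun n => sub_nonneg.2 (hF n)]
    refine (ha.sub_const (F 0)).congr fun n => ?_
    have := Finset.sum_range_sub (fun n : ℕ => F n) n
    push_cast at this
    exact this.symm
  have h2 : HasSum (fun n : ℕ => F (-((n : ℤ) + 1) + 1) - F (-((n : ℤ) + 1))) (F 0 - b) := by
    rw [hasSum_iff_tendsto_nat_of_nonneg fun n => sub_nonneg.2 (hF _)]
    refine (hb.const_sub (F 0)).congr fun n => ?_
    have := Finset.sum_range_sub' (fun n : ℕ => F (-(n : ℤ))) n
    push_cast at this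
    rw [neg_zero] at this
    rw [← this]
    refine Finset.sum_congr rfl fun i _ => ?_
    congr 2
    ring
  have h3 := HasSum.of_nat_of_neg_add_one (f := fun l => F (l + 1) - F l) h1 h2
  rwa [sub_add_sub_cancel] at h3

theorem tendsto_gridSq_atTop (hq0 : 0 < q) (hq1 : q < 1) (α : ℝ) :
    Filter.Tendsto (gridSq q α) Filter.atTop (nhds 0) := by
  have h : Filter.Tendsto (fun n : ℕ => gridSq q α n) Filter.atTop (nhds 0) := by
    simp only [gridSq_natCast]
    simpa using (tendsto_pow_atTop_nhds_zero_of_lt_one (by positivity)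
      (by nlinarith : q ^ 2 < 1)).const_mul (α ^ 2)
  rw [← Nat.map_cast_int_atTop, Filter.tendsto_map'_iff]
  exact h

/-- The square of the Hilbert--Schmidt norm of `L`. -/
theorem hasSum_jacobi_sq (hq0 : 0 < q) (hq1 : q < 1) (hα : α ≠ 0) (hβ : 0 ≤ β) :
    HasSum (fun l => offDiag q α β l ^ 2 + onDiag q α β l ^ 2 + offDiag q α β (l + 1) ^ 2)
      ((1 + (β * q) ^ 2) / (1 - q ^ 2)) := by
  have hstep : ∀ l, hsPrim q β (gridSq q α (l + 1)) - hsPrim q β (gridSq q α l) =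
      offDiag q α β l ^ 2 + onDiag q α β l ^ 2 + offDiag q α β (l + 1) ^ 2 := by
    intro l
    rw [offDiag_sq hq0 hα hβ, offDiag_sq hq0 hα hβ, onDiag, gridSq_add_one α hq0,
      hsPrim_sub β hq0 hq1 (gridSq_pos hq0 hα l), mul_div_cancel_right₀ _ (by positivity)]
  have hneg : Filter.Tendsto (fun n : ℕ => gridSq q α (-(n : ℤ))) Filter.atTop Filter.atTop := by
    have h : Filter.Tendsto (fun n : ℕ => (gridSq q α (-(n : ℤ)))⁻¹) Filter.atTop
        (nhdsWithin 0 (Set.Ioi 0)) := by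
      refine tendsto_nhdsWithin_iff.2 ⟨?_, Filter.Eventually.of_forall fun n =>
        inv_pos.2 (gridSq_pos hq0 hα _)⟩
      simp only [inv_gridSq_neg_natCast]
      simpa using (tendsto_pow_atTop_nhds_zero_of_lt_one (by positivity)
        (by nlinarith : q ^ 2 < 1)).const_mul (α ^ 2)⁻¹
    refine h.inv_tendsto_nhdsGT_zero.congr fun n => ?_
    rw [Pi.inv_apply, inv_inv]
  have hinf : Filter.Tendsto (hsPrim q β) Filter.atTop (nhds 0) := by
    have h : ∀ a b : ℝ, Filter.Tendsto (fun s : ℝ => a / (s + b)) Filter.atTop (nhds 0) :=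
      fun a b => (Filter.tendsto_atTop_add_const_right _ b Filter.tendsto_id).const_div_atTop a
    have h3 := ((h (q * (1 - β * q) ^ 2 * (1 + q ^ 2)) q).sub
      (((h 1 1).add (h (q ^ 2) (q ^ 2))).const_mul (q * (1 - β * q ^ 2) * (1 - β)))).div_const
        ((1 - q) ^ 2 * (1 - q ^ 2))
    rw [add_zero, mul_zero, sub_zero, zero_div] at h3
    exact h3.congr fun s => by rw [hsPrim]
  have hcont : ContinuousAt (hsPrim q β) 0 := by
    unfold hsPrim
    fun_prop (disch := simp [hq0.ne'])
  have h := hasSum_int_telescope (F := fun l => hsPrim q β (gridSq q α l)) (fun l => ?_)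
    (hcont.tendsto.comp ((tendsto_gridSq_atTop hq0 hq1 α).comp tendsto_natCast_atTop_atTop))
    (hinf.comp hneg)
  · rw [hsPrim_zero β hq0 hq1, sub_zero] at h
    simpa only [hstep] using h
  · refine sub_nonneg.1 (le_of_le_of_eq ?_ (hstep l).symm)
    positivity

theorem abs_offDiag_le (hq0 : 0 < q) (hq1 : q < 1) (hα : α ≠ 0) (hβ : 0 ≤ β) :
    ∃ J, ∀ l, |offDiag q α β l| ≤ J := by
  have h := hasSum_jacobi_sq hq0 hq1 hα hβ
  refine ⟨√((1 + (β * q) ^ 2) / (1 - q ^ 2)), fun l => Real.abs_le_sqrt ?_⟩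
  refine le_trans ?_ (le_hasSum h l fun m _ => by positivity)
  have := sq_nonneg (onDiag q α β l)
  have := sq_nonneg (offDiag q α β (l + 1))
  linarith

/-! ### Triviality of the kernel -/

theorem eq_zero_of_eventually_zero {j c : ℤ → ℝ} (hj : ∀ l, j l ≠ 0) {g : ℤ → ℂ}
    (hg : ∀ l, j l * g (l - 1) + c l * g l + j (l + 1) * g (l + 1) = 0) {N : ℤ}
    (hN : ∀ l, N ≤ l → g l = 0) (l : ℤ) : g l = 0 := by
  have key : ∀ k : ℕ, ∀ l, N - k ≤ l → g l = 0 := by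
    intro k
    induction k with
    | zero => simpa using hN
    | succ k ih =>
      intro l hl
      by_cases h : N - k ≤ l
      · exact ih l h
      · have h1 := hg (l + 1)
        have hlN : N - k ≤ l + 1 := by push_cast at hl; omega
        rw [ih _ hlN, ih (l + 1 + 1) (by omega), mul_zero, mul_zero, add_zero, add_zero,
          add_sub_cancel_right] at h1
        exact (mul_eq_zero.1 h1).resolve_left (by exact_mod_cast hj (l + 1))
  exact key (N - l).toNat l (by have := Int.self_le_toNat (N - l); omega)

/-- Bounded solutions of a three-term recurrence vanish when the off-diagonal entries decay
geometrically and dominate the diagonal ones near `+∞`. -/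
theorem eq_zero_of_recurrence_of_dominated {j c : ℤ → ℝ} (hj : ∀ l, 0 < j l) {g : ℤ → ℂ}
    (hg : ∀ l, j l * g (l - 1) + c l * g l + j (l + 1) * g (l + 1) = 0) {M : ℝ}
    (hM : ∀ l, ‖g l‖ ≤ M) {r₁ r₂ : ℝ} (h1 : 0 ≤ r₁) (h2 : 0 ≤ r₂) (hr : r₁ + r₂ < 1)
    (hdom : ∀ᶠ l in Filter.atTop, j (l + 1) ≤ r₁ * j l ∧ |c l| ≤ r₂ * j l) (l : ℤ) : g l = 0 := by
  obtain ⟨N, hN⟩ := Filter.eventually_atTop.1 hdom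
  refine eq_zero_of_eventually_zero (fun l => (hj l).ne') hg (N := N) (fun l hl => ?_) l
  have key : ∀ k : ℕ, ∀ l, N ≤ l → ‖g l‖ ≤ (r₁ + r₂) ^ k * M := by
    intro k
    induction k with
    | zero => intro l _; simpa using hM l
    | succ k ih =>
      intro l hl
      obtain ⟨d1, d2⟩ := hN (l + 1) (by omega)
      have e := hg (l + 1)
      rw [add_sub_cancel_right] at e
      have hjl := hj (l + 1)
      have i1 := ih (l + 1) (by omega)
      have i2 := ih (l + 1 + 1) (by omega)
      have e' : (j (l + 1) : ℂ) * g l =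
          -(c (l + 1) * g (l + 1) + j (l + 1 + 1) * g (l + 1 + 1)) := by
        linear_combination e
      have e2 := congrArg norm e'
      rw [norm_neg, norm_mul, Complex.norm_real, Real.norm_of_nonneg hjl.le] at e2
      have e3 := e2.le.trans (norm_add_le _ _)
      rw [norm_mul, norm_mul, Complex.norm_real, Complex.norm_real, Real.norm_eq_abs,
        Real.norm_of_nonneg (hj _).le] at e3
      have e4 := mul_le_mul d2 i1 (norm_nonneg _) (by positivity)
      have e5 := mul_le_mul d1 i2 (norm_nonneg _) (by positivity)
      refine le_of_mul_le_mul_left ?_ hjl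
      refine e3.trans ((add_le_add e4 e5).trans (le_of_eq ?_))
      ring
  have ht : Filter.Tendsto (fun k : ℕ => (r₁ + r₂) ^ k * M) Filter.atTop (nhds 0) := by
    simpa using (tendsto_pow_atTop_nhds_zero_of_lt_one (by positivity) hr).mul_const M
  exact norm_le_zero_iff.1 (ge_of_tendsto' ht fun k => key k l hl)

theorem offDiag_dominates (hq0 : 0 < q) (hq1 : q < 1) (hα : α ≠ 0) (hβ : 0 < β) :
    ∀ᶠ l in Filter.atTop, offDiag q α β (l + 1) ≤ (1 + q) / 2 * offDiag q α β l ∧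
      |onDiag q α β l| ≤ (1 - q) / 4 * offDiag q α β l := by
  -- The squared entries are `s E(s)` and `s² K(s)²`, with `E` and `K` continuous and `E` positive
  -- at `s = 0`.
  set E : ℝ → ℝ := fun s =>
    q * (1 + β * s) * (s + β * q ^ 2) / ((1 + s) * (s + q) ^ 2 * (s + q ^ 2)) with hE
  set K : ℝ → ℝ := fun s => (1 + q) * (1 - β * q) / ((q + s) * (1 + q * s)) with hK
  have hE' : ∀ s, 0 < s → coefA q β s * coefB q β (s / q ^ 2) = s * E s := by
    intro s hs
    have f2 : 1 + s / q ^ 2 = (s + q ^ 2) / q ^ 2 := by field_simp; ring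
    have f3 : 1 + q * (s / q ^ 2) = (s + q) / q := by field_simp; ring
    simp only [hE, coefA, coefB]
    rw [f2, f3, add_comm q s]
    field_simp
  have hcE : ContinuousAt E 0 := by
    simp only [hE]
    fun_prop (disch := simp [hq0.ne'])
  have hcE2 : ContinuousAt (fun s => E (s * q ^ 2)) 0 := by
    simp only [hE]
    fun_prop (disch := simp [hq0.ne'])
  have hcK : ContinuousAt (fun s => s * K s ^ 2) 0 := by
    simp only [hK]
    fun_prop (disch := simp [hq0.ne'])
  have hE0 : 0 < E 0 := by simp only [hE]; positivity
  have hlim := tendsto_gridSq_atTop hq0 hq1 α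
  have ev1 := ((hcE2.const_mul (q ^ 2)).tendsto.comp hlim).eventually_lt
    ((hcE.const_mul (((1 + q) / 2) ^ 2)).tendsto.comp hlim) (by
      simp only [zero_mul]
      refine mul_lt_mul_of_pos_right ?_ hE0
      nlinarith)
  have ev2 := (hcK.tendsto.comp hlim).eventually_lt
    ((hcE.const_mul (((1 - q) / 4) ^ 2)).tendsto.comp hlim) (by
      simp only [zero_mul]
      have : 0 < 1 - q := by linarith
      positivity)
  filter_upwards [ev1, ev2] with l h1 h2
  simp only [Function.comp_apply] at h1 h2
  have hs := gridSq_pos hq0 hα l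
  have hj := offDiag_pos (β := β) hq0 hα hβ.le l
  have hj' := offDiag_pos (β := β) hq0 hα hβ.le (l + 1)
  have s1 := offDiag_sq hq0 hα hβ.le l
  have s2 := offDiag_sq hq0 hα hβ.le (l + 1)
  rw [hE' _ hs] at s1
  rw [hE' _ (gridSq_pos hq0 hα _), gridSq_add_one α hq0] at s2
  constructor
  · refine le_of_sq_le_sq ?_ (by positivity)
    rw [s2, mul_pow, s1]
    nlinarith
  · refine abs_le_of_sq_le_sq ?_ (mul_nonneg (by linarith) hj.le)
    have : onDiag q α β l = gridSq q α l * K (gridSq q α l) := by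
      simp only [onDiag, coefC, hK]
      ring
    rw [this, mul_pow, mul_pow, s1]
    nlinarith

/-- For `β = 0` the substitution `g_l = (-1)^l (q^{-l} (1 + s_l))^{1/2} k_l` turns the recurrence
for the kernel into one solved by constant `k`, hence into a first-order recurrence for the
differences of `k`. Near `+∞` these do not decrease in absolute value, whereas `k` tends to `0`. -/
theorem eq_zero_of_recurrence_zero (hq0 : 0 < q) (hq1 : q < 1) (hα : α ≠ 0) {g : ℤ → ℂ}
    (hg : ∀ l, offDiag q α 0 l * g (l - 1) + onDiag q α 0 l * g l +
      offDiag q α 0 (l + 1) * g (l + 1) = 0) {M : ℝ} (hM : ∀ l, ‖g l‖ ≤ M) (l : ℤ) : g l = 0 := by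
  set ρ : ℤ → ℝ := fun l => √((q ^ l)⁻¹ * (1 + gridSq q α l)) with hρ
  have hs := fun l => gridSq_pos (q := q) hq0 hα l
  have hz := fun l : ℤ => zpow_pos hq0 l
  have hrad : ∀ l, 0 < (q ^ l)⁻¹ * (1 + gridSq q α l) := fun l =>
    mul_pos (inv_pos.2 (hz l)) (by linarith [hs l])
  have hρpos : ∀ l, 0 < ρ l := fun l => Real.sqrt_pos.2 (hrad l)
  have hρsq : ∀ l, ρ l ^ 2 = (q ^ l)⁻¹ * (1 + gridSq q α l) := fun l => Real.sq_sqrt (hrad l).le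
  have hprod : ∀ l, offDiag q α 0 (l + 1) * ρ l * ρ (l + 1) =
      (q ^ l)⁻¹ * gridSq q α l / (1 + q * gridSq q α l) := by
    intro l
    have h1 := hs l
    have h2 := hz l
    have hp := mul_pos (mul_pos (offDiag_pos (β := 0) hq0 hα le_rfl (l + 1)) (hρpos l))
      (hρpos (l + 1))
    rw [← sq_eq_sq₀ hp.le (by positivity), mul_pow, mul_pow, hρsq, hρsq, offDiag_sq hq0 hα le_rfl,
      gridSq_add_one α hq0, zpow_add_one₀ hq0.ne', mul_div_cancel_right₀ _ (by positivity), coefA,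
      coefB]
    generalize gridSq q α l = s at *
    generalize q ^ l = z at *
    field_simp
    ring
  set k : ℤ → ℂ := fun l => (-1) ^ l * g l / ρ l with hk
  have hgk : ∀ l, g l = (-1) ^ l * ρ l * k l := by
    intro l
    have h1 : (ρ l : ℂ) ≠ 0 := by exact_mod_cast (hρpos l).ne'
    have h2 : ((-1 : ℂ) ^ l) * (-1) ^ l = 1 := by
      rw [← mul_zpow]; simp
    simp only [hk]
    field_simp
    linear_combination -g l * h2
  have hstep : ∀ l, (q + gridSq q α l : ℂ) * (k (l + 1) - k l) =
      (1 + q * gridSq q α l) * (k l - k (l - 1)) := by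
    intro l
    have h := hg l
    have p0 := hprod (l - 1)
    have p1 := hprod l
    have r0 := hρsq l
    rw [sub_add_cancel, gridSq_sub_one α hq0, zpow_sub_one₀ hq0.ne'] at p0
    have hm : ((-1 : ℂ) ^ (l - 1)) = -(-1) ^ l := by
      rw [zpow_sub_one₀ (by norm_num)]; norm_num
    have hm' : ((-1 : ℂ) ^ (l + 1)) = -(-1) ^ l := by
      rw [zpow_add_one₀ (by norm_num)]; norm_num
    have hm0 : ((-1 : ℂ) ^ l) ≠ 0 := zpow_ne_zero _ (by norm_num)
    rw [hgk (l - 1), hgk l, hgk (l + 1), hm, hm', onDiag, coefC] at h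
    have h1 := hs l
    have h2 := hz l
    have hden : (q + gridSq q α l) * (1 + q * gridSq q α l) ≠ 0 := by positivity
    have P0 : offDiag q α 0 l * ρ (l - 1) * ρ l * (q + gridSq q α l) =
        (q ^ l)⁻¹ * gridSq q α l := by
      rw [p0]
      field_simp
    have P1 : offDiag q α 0 (l + 1) * ρ l * ρ (l + 1) * (1 + q * gridSq q α l) =
        (q ^ l)⁻¹ * gridSq q α l := by
      rw [p1]
      field_simp
    have R0 : ρ l ^ 2 * (gridSq q α l * (1 + q) * (1 - 0 * q) /
        ((q + gridSq q α l) * (1 + q * gridSq q α l))) *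
        ((q + gridSq q α l) * (1 + q * gridSq q α l)) =
        (q ^ l)⁻¹ * gridSq q α l * ((1 + q) * (1 + gridSq q α l)) := by
      rw [r0]
      field_simp
      ring
    have hne : (q ^ l)⁻¹ * gridSq q α l ≠ 0 := by positivity
    generalize (q ^ l)⁻¹ * gridSq q α l = t at *
    generalize gridSq q α l * (1 + q) * (1 - 0 * q) /
        ((q + gridSq q α l) * (1 + q * gridSq q α l)) = cc at *
    have P0c : (offDiag q α 0 l * ρ (l - 1) * ρ l * (q + gridSq q α l) : ℂ) = t := by
      exact_mod_cast P0
    have P1c : (offDiag q α 0 (l + 1) * ρ l * ρ (l + 1) * (1 + q * gridSq q α l) : ℂ) = t := by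
      exact_mod_cast P1
    have R0c : (ρ l ^ 2 * cc * ((q + gridSq q α l) * (1 + q * gridSq q α l)) : ℂ) =
        t * ((1 + q) * (1 + gridSq q α l)) := by
      exact_mod_cast R0
    have htc : (t : ℂ) ≠ 0 := by exact_mod_cast hne
    refine mul_left_cancel₀ (mul_ne_zero hm0 htc) ?_
    linear_combination (-(ρ l : ℂ) * ((q + gridSq q α l) * (1 + q * gridSq q α l))) * h -
      (-1) ^ l * k (l - 1) * (1 + q * gridSq q α l) * P0c -
      (-1) ^ l * k (l + 1) * (q + gridSq q α l) * P1c +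
      (-1) ^ l * k l * R0c
  have hgrow : ∃ N, ∀ l, N ≤ l → ‖k l - k (l - 1)‖ ≤ ‖k (l + 1) - k l‖ := by
    obtain ⟨N, hN⟩ := Filter.eventually_atTop.1
      ((tendsto_gridSq_atTop hq0 hq1 α).eventually_le_const zero_lt_one)
    refine ⟨N, fun l hl => ?_⟩
    have h1 := hN l hl
    have h2 := hs l
    have h := congrArg norm (hstep l)
    have n1 : ‖(q + gridSq q α l : ℂ)‖ = q + gridSq q α l := by
      rw [← Complex.ofReal_add, Complex.norm_real, Real.norm_of_nonneg (by positivity)]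
    have n2 : ‖(1 + q * gridSq q α l : ℂ)‖ = 1 + q * gridSq q α l := by
      rw [← Complex.ofReal_mul, ← Complex.ofReal_one, ← Complex.ofReal_add, Complex.norm_real,
        Real.norm_of_nonneg (by positivity)]
    rw [norm_mul, norm_mul, n1, n2] at h
    have h3 : q + gridSq q α l ≤ 1 + q * gridSq q α l := by nlinarith
    have h4 := mul_le_mul_of_nonneg_right h3 (norm_nonneg (k l - k (l - 1)))
    rw [← h] at h4
    exact le_of_mul_le_mul_left h4 (by positivity)
  have hk0 : Filter.Tendsto k Filter.atTop (nhds 0) := by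
    refine squeeze_zero_norm (a := fun l => M * √(q ^ l)) (fun l => ?_) ?_
    · have h1 := hz l
      have hkn : ‖k l‖ = ‖g l‖ / ρ l := by
        simp only [hk]
        rw [norm_div, norm_mul, norm_zpow, norm_neg, norm_one, one_zpow, one_mul,
          Complex.norm_real, Real.norm_of_nonneg (hρpos l).le]
      have hM0 : 0 ≤ M := (norm_nonneg _).trans (hM l)
      have h2 : 1 ≤ √(q ^ l) * ρ l := by
        rw [hρ, ← Real.sqrt_mul h1.le, ← mul_assoc, mul_inv_cancel₀ h1.ne', one_mul]
        exact Real.one_le_sqrt.2 (by linarith [hs l])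
      rw [hkn, div_le_iff₀ (hρpos l), mul_assoc]
      exact (hM l).trans (le_mul_of_one_le_right hM0 h2)
    · have h1 : Filter.Tendsto (fun l : ℤ => q ^ l) Filter.atTop (nhds 0) := by
        rw [← Nat.map_cast_int_atTop, Filter.tendsto_map'_iff]
        simpa [Function.comp_def] using tendsto_pow_atTop_nhds_zero_of_lt_one hq0.le hq1
      simpa using (h1.sqrt).const_mul M
  obtain ⟨N, hN⟩ := hgrow
  have hd : ∀ l, N ≤ l → k l = k (l - 1) := by
    intro l hl
    have h1 : ∀ n : ℕ, ‖k l - k (l - 1)‖ ≤ ‖k (l + n) - k (l + n - 1)‖ := by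
      intro n
      induction n with
      | zero => simp
      | succ n ih =>
        refine ih.trans ((hN (l + n) (by omega)).trans (le_of_eq ?_))
        push_cast
        congr 2
        · congr 1; ring
        · congr 1; ring
    have ht : Filter.Tendsto (fun n : ℕ => ‖k (l + n) - k (l + n - 1)‖) Filter.atTop (nhds 0) := by
      have a1 : Filter.Tendsto (fun n : ℕ => l + (n : ℤ)) Filter.atTop Filter.atTop :=
        Filter.tendsto_atTop_add_const_left _ _ tendsto_natCast_atTop_atTop
      have a2 : Filter.Tendsto (fun n : ℕ => l + (n : ℤ) - 1) Filter.atTop Filter.atTop := by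
        simpa only [sub_eq_add_neg] using Filter.tendsto_atTop_add_const_right _ _ a1
      simpa using ((hk0.comp a1).sub (hk0.comp a2)).norm
    exact sub_eq_zero.1 (norm_le_zero_iff.1 (ge_of_tendsto' ht h1))
  have hconst : ∀ l, N ≤ l → k l = 0 := by
    intro l hl
    have h1 : ∀ n : ℕ, k (l + n) = k l := by
      intro n
      induction n with
      | zero => simp
      | succ n ih =>
        rw [hd _ (by omega), ← ih]
        congr 1
        push_cast
        ring
    have a1 : Filter.Tendsto (fun n : ℕ => l + (n : ℤ)) Filter.atTop Filter.atTop :=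
      Filter.tendsto_atTop_add_const_left _ _ tendsto_natCast_atTop_atTop
    have h2 := hk0.comp a1
    exact tendsto_nhds_unique (tendsto_const_nhds.congr fun n => (h1 n).symm) h2
  exact eq_zero_of_eventually_zero (fun l => (offDiag_pos hq0 hα le_rfl l).ne') hg
    (fun l hl => by rw [hgk, hconst l hl, mul_zero]) l

/-- The symmetrized matrix of `L` has no bounded, in particular no square summable, null vector. -/
theorem eq_zero_of_jacobi_kernel (hq0 : 0 < q) (hq1 : q < 1) (hα : α ≠ 0) (hβ : 0 ≤ β) {g : ℤ → ℂ}
    (hg : ∀ l, offDiag q α β l * g (l - 1) + onDiag q α β l * g l +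
      offDiag q α β (l + 1) * g (l + 1) = 0) {M : ℝ} (hM : ∀ l, ‖g l‖ ≤ M) (l : ℤ) : g l = 0 := by
  rcases hβ.eq_or_lt with rfl | hβ'
  · exact eq_zero_of_recurrence_zero hq0 hq1 hα hg hM l
  · exact eq_zero_of_recurrence_of_dominated (offDiag_pos hq0 hα hβ) hg hM (by linarith)
      (by linarith) (by linarith) (offDiag_dominates hq0 hq1 hα hβ') l

end

/-! ### The Hilbert space of the measure -/

/-- The normalized mass at `x_l(α)`. -/
def ascMass (q α β : ℝ) (l : ℤ) : ℝ := ascWeight q α β l / ∑' m : ℤ, ascWeight q α β m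

section
variable {q α β : ℝ}

theorem tsum_ascWeight_pos (hq0 : 0 < q) (hq1 : q < 1) (hα : α ≠ 0) (hβ : 0 ≤ β) :
    0 < ∑' m : ℤ, ascWeight q α β m :=
  (summable_ascWeight hq0 hq1 hα hβ).tsum_pos (fun l => (ascWeight_pos hq0 hq1 hα hβ l).le) 0
    (ascWeight_pos hq0 hq1 hα hβ 0)

theorem ascMass_pos (hq0 : 0 < q) (hq1 : q < 1) (hα : α ≠ 0) (hβ : 0 ≤ β) (l : ℤ) :
    0 < ascMass q α β l :=
  div_pos (ascWeight_pos hq0 hq1 hα hβ l) (tsum_ascWeight_pos hq0 hq1 hα hβ)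

theorem hasSum_ascMass (hq0 : 0 < q) (hq1 : q < 1) (hα : α ≠ 0) (hβ : 0 ≤ β) :
    HasSum (ascMass q α β) 1 := by
  have h := (summable_ascWeight hq0 hq1 hα hβ).hasSum.div_const (∑' m : ℤ, ascWeight q α β m)
  rwa [div_self (tsum_ascWeight_pos hq0 hq1 hα hβ).ne'] at h

theorem ascMeasure_eq (q α β : ℝ) : ascMeasure q α β = Measure.sum fun l : ℤ =>
    ENNReal.ofReal (ascMass q α β l) • Measure.dirac (gridPoint q α l) := rfl

theorem isProbabilityMeasure_ascMeasure (hq0 : 0 < q) (hq1 : q < 1) (hα : α ≠ 0) (hβ : 0 ≤ β) :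
    IsProbabilityMeasure (ascMeasure q α β) := by
  constructor
  have h := hasSum_ascMass hq0 hq1 hα hβ
  rw [ascMeasure_eq, Measure.sum_apply _ MeasurableSet.univ]
  simp only [Measure.smul_apply, measure_univ, smul_eq_mul, mul_one]
  rw [← ENNReal.ofReal_tsum_of_nonneg (fun l => (ascMass_pos hq0 hq1 hα hβ l).le) h.summable,
    h.tsum_eq, ENNReal.ofReal_one]

theorem ae_ascMeasure_iff (hq0 : 0 < q) (hq1 : q < 1) (hα : α ≠ 0) (hβ : 0 ≤ β) {p : ℝ → Prop} :
    (∀ᵐ x ∂ascMeasure q α β, p x) ↔ ∀ l, p (gridPoint q α l) := by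
  rw [ascMeasure_eq, Measure.ae_sum_iff]
  refine forall_congr' fun l => ?_
  rw [Measure.ae_ennreal_smul_measure_iff (by simpa using ascMass_pos hq0 hq1 hα hβ l), ae_dirac_eq]
  exact Filter.eventually_pure

theorem memLp_ascMeasure_iff (hq0 : 0 < q) (hq1 : q < 1) (hα : α ≠ 0) (hβ : 0 ≤ β) {f : ℝ → ℂ} :
    MemLp f 2 (ascMeasure q α β) ↔
      Summable fun l => ascWeight q α β l * ‖f (gridPoint q α l)‖ ^ 2 := by
  have hm : AEStronglyMeasurable f (ascMeasure q α β) := by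
    rw [ascMeasure_eq, aestronglyMeasurable_sum_measure_iff]
    exact fun l => aestronglyMeasurable_dirac.smul_measure _
  rw [memLp_two_iff_integrable_sq_norm hm, ascMeasure_eq,
    integrable_sum_dirac_iff fun l => ENNReal.ofReal_ne_top,
    ← summable_mul_right_iff (tsum_ascWeight_pos hq0 hq1 hα hβ).ne' (f := fun l =>
      (ENNReal.ofReal (ascMass q α β l)).toReal * ‖‖f (gridPoint q α l)‖ ^ 2‖)]
  refine summable_congr fun l => ?_
  rw [ENNReal.toReal_ofReal (ascMass_pos hq0 hq1 hα hβ l).le, norm_pow, norm_norm, ascMass]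
  have := (tsum_ascWeight_pos hq0 hq1 hα hβ).ne'
  field_simp

theorem ascMeasure_singleton (hq0 : 0 < q) (hq1 : q < 1) (hα : α ≠ 0) (l : ℤ) :
    ascMeasure q α β {gridPoint q α l} = ENNReal.ofReal (ascMass q α β l) := by
  rw [ascMeasure_eq, Measure.sum_apply _ (measurableSet_singleton _), tsum_eq_single l]
  · simp
  · intro m hm
    have : gridPoint q α m ≠ gridPoint q α l := fun h => hm (gridPoint_injective hq0 hq1 hα h)
    simp [this]

theorem measureReal_singleton (hq0 : 0 < q) (hq1 : q < 1) (hα : α ≠ 0) (hβ : 0 ≤ β) (l : ℤ) :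
    (ascMeasure q α β).real {gridPoint q α l} = ascMass q α β l := by
  rw [Measure.real, ascMeasure_singleton hq0 hq1 hα,
    ENNReal.toReal_ofReal (ascMass_pos hq0 hq1 hα hβ l).le]

/-- The normalized indicator function of the grid point `x_l(α)`. -/
def gridVec (hq0 : 0 < q) (hq1 : q < 1) (hα : α ≠ 0) (l : ℤ) : Lp ℂ 2 (ascMeasure q α β) :=
  (((√(ascMass q α β l))⁻¹ : ℝ) : ℂ) •
    indicatorConstLp 2 (measurableSet_singleton (gridPoint q α l))
      (by rw [ascMeasure_singleton hq0 hq1 hα]; exact ENNReal.ofReal_ne_top) (1 : ℂ)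

theorem inner_gridVec (hq0 : 0 < q) (hq1 : q < 1) (hα : α ≠ 0) (hβ : 0 ≤ β) (l : ℤ)
    (f : Lp ℂ 2 (ascMeasure q α β)) :
    inner ℂ (gridVec hq0 hq1 hα l) f = √(ascMass q α β l) * f (gridPoint q α l) := by
  have hm := ascMass_pos hq0 hq1 hα hβ l
  have hs : (√(ascMass q α β l) : ℂ) ≠ 0 := by exact_mod_cast (Real.sqrt_pos.2 hm).ne'
  have hss : (√(ascMass q α β l) : ℂ) * √(ascMass q α β l) = ascMass q α β l := by
    exact_mod_cast Real.mul_self_sqrt hm.le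
  rw [gridVec, inner_smul_left, L2.inner_indicatorConstLp_one, integral_singleton,
    measureReal_singleton hq0 hq1 hα hβ, Complex.conj_ofReal, Complex.real_smul, ← hss]
  push_cast
  field_simp

theorem gridVec_apply (hq0 : 0 < q) (hq1 : q < 1) (hα : α ≠ 0) (hβ : 0 ≤ β) (l m : ℤ) :
    gridVec (β := β) hq0 hq1 hα l (gridPoint q α m) =
      if m = l then (((√(ascMass q α β l))⁻¹ : ℝ) : ℂ) else 0 := by
  have h1 := (ae_ascMeasure_iff hq0 hq1 hα hβ).1 (Lp.coeFn_smul (((√(ascMass q α β l))⁻¹ : ℝ) : ℂ)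
    (indicatorConstLp (μ := ascMeasure q α β) 2 (measurableSet_singleton (gridPoint q α l))
      (by rw [ascMeasure_singleton hq0 hq1 hα]; exact ENNReal.ofReal_ne_top) (1 : ℂ))) m
  have h2 := (ae_ascMeasure_iff hq0 hq1 hα hβ).1 (indicatorConstLp_coeFn
    (μ := ascMeasure q α β) (p := 2) (hs := measurableSet_singleton (gridPoint q α l))
    (hμs := by rw [ascMeasure_singleton hq0 hq1 hα]; exact ENNReal.ofReal_ne_top) (c := (1 : ℂ))) m
  rw [gridVec, h1, Pi.smul_apply, h2]
  by_cases h : m = l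
  · simp [h]
  · have : gridPoint q α m ≠ gridPoint q α l := fun e => h (gridPoint_injective hq0 hq1 hα e)
    simp [h, this]

theorem orthonormal_gridVec (hq0 : 0 < q) (hq1 : q < 1) (hα : α ≠ 0) (hβ : 0 ≤ β) :
    Orthonormal ℂ (gridVec (β := β) hq0 hq1 hα) := by
  rw [orthonormal_iff_ite]
  intro l m
  rw [inner_gridVec hq0 hq1 hα hβ, gridVec_apply hq0 hq1 hα hβ]
  split_ifs with h
  · subst h
    rw [← Complex.ofReal_mul, mul_inv_cancel₀ (Real.sqrt_pos.2 (ascMass_pos hq0 hq1 hα hβ l)).ne',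
      Complex.ofReal_one]
  · rw [mul_zero]

/-- The normalized indicator functions of the grid points form a Hilbert basis. -/
def gridBasis (hq0 : 0 < q) (hq1 : q < 1) (hα : α ≠ 0) (hβ : 0 ≤ β) :
    HilbertBasis ℤ ℂ (Lp ℂ 2 (ascMeasure q α β)) :=
  HilbertBasis.mkOfOrthogonalEqBot (orthonormal_gridVec hq0 hq1 hα hβ) (by
    rw [Submodule.eq_bot_iff]
    intro f hf
    rw [Lp.eq_zero_iff_ae_eq_zero]
    refine (ae_ascMeasure_iff hq0 hq1 hα hβ).2 fun l => ?_
    have h := (Submodule.mem_orthogonal _ _).1 hf _ (Submodule.subset_span ⟨l, rfl⟩)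
    rw [inner_gridVec hq0 hq1 hα hβ] at h
    refine (mul_eq_zero.1 h).resolve_left ?_
    exact_mod_cast (Real.sqrt_pos.2 (ascMass_pos hq0 hq1 hα hβ l)).ne')

theorem inner_gridBasis (hq0 : 0 < q) (hq1 : q < 1) (hα : α ≠ 0) (hβ : 0 ≤ β) (l : ℤ)
    (f : Lp ℂ 2 (ascMeasure q α β)) :
    inner ℂ (gridBasis hq0 hq1 hα hβ l) f = √(ascMass q α β l) * f (gridPoint q α l) := by
  rw [gridBasis, HilbertBasis.coe_mkOfOrthogonalEqBot, inner_gridVec hq0 hq1 hα hβ]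

/-- Conjugation by the square roots of the masses turns the off-diagonal coefficients of `L` into
the symmetric entries `offDiag`. -/
theorem offDiag_mul_sqrt_ascMass (hq0 : 0 < q) (hq1 : q < 1) (hα : α ≠ 0) (hβ : 0 ≤ β) (l : ℤ) :
    offDiag q α β (l + 1) * √(ascMass q α β l) =
      √(ascMass q α β (l + 1)) * coefA q β (gridSq q α (l + 1)) ∧
    offDiag q α β (l + 1) * √(ascMass q α β (l + 1)) =
      √(ascMass q α β l) * coefB q β (gridSq q α l) := by
  have m0 := ascMass_pos hq0 hq1 hα hβ l
  have m1 := ascMass_pos hq0 hq1 hα hβ (l + 1)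
  have hA := coefA_pos hq0 hβ (gridSq_pos hq0 hα (l + 1))
  have hB := coefB_pos hq0 hβ (gridSq_pos hq0 hα l)
  have hj := offDiag_pos hq0 hα hβ (l + 1)
  have hjj : offDiag q α β (l + 1) ^ 2 =
      coefA q β (gridSq q α (l + 1)) * coefB q β (gridSq q α l) := by
    rw [offDiag, add_sub_cancel_right, Real.sq_sqrt (mul_pos hA hB).le]
  have hw : ascMass q α β (l + 1) * coefA q β (gridSq q α (l + 1)) =
      ascMass q α β l * coefB q β (gridSq q α l) := by
    rw [ascMass, ascMass, div_mul_eq_mul_div, div_mul_eq_mul_div,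
      ascWeight_gridSq hq0 hq1 hα hβ]
  constructor
  · rw [← sq_eq_sq₀ (by positivity) (by positivity), mul_pow, mul_pow, Real.sq_sqrt m0.le,
      Real.sq_sqrt m1.le, hjj]
    linear_combination -coefA q β (gridSq q α (l + 1)) * hw
  · rw [← sq_eq_sq₀ (by positivity) (by positivity), mul_pow, mul_pow, Real.sq_sqrt m0.le,
      Real.sq_sqrt m1.le, hjj]
    linear_combination coefB q β (gridSq q α l) * hw

theorem IsGridEigen.isJacobiEigen (hq0 : 0 < q) (hq1 : q < 1) (hα : α ≠ 0) (hβ : 0 ≤ β)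
    {f : ℝ → ℂ} {t : ℝ} (hf : IsGridEigen q α β f t) {F : Lp ℂ 2 (ascMeasure q α β)}
    (hF : F =ᵐ[ascMeasure q α β] f) :
    IsJacobiEigen (gridBasis hq0 hq1 hα hβ) (offDiag q α β) (onDiag q α β) F t := by
  intro l
  have h := (ae_ascMeasure_iff hq0 hq1 hα hβ).1 hF
  have h1 := (offDiag_mul_sqrt_ascMass hq0 hq1 hα hβ (l - 1)).1
  have h2 := (offDiag_mul_sqrt_ascMass hq0 hq1 hα hβ l).2
  rw [sub_add_cancel] at h1
  have h1' : (offDiag q α β l * √(ascMass q α β (l - 1)) : ℂ) =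
      √(ascMass q α β l) * coefA q β (gridSq q α l) := by exact_mod_cast h1
  have h2' : (offDiag q α β (l + 1) * √(ascMass q α β (l + 1)) : ℂ) =
      √(ascMass q α β l) * coefB q β (gridSq q α l) := by exact_mod_cast h2
  simp only [inner_gridBasis, h, onDiag]
  linear_combination f (gridPoint q α (l - 1)) * h1' + f (gridPoint q α (l + 1)) * h2' +
    √(ascMass q α β l) * hf l

theorem eq_zero_of_isJacobiEigen_zero (hq0 : 0 < q) (hq1 : q < 1) (hα : α ≠ 0) (hβ : 0 ≤ β)
    {v : Lp ℂ 2 (ascMeasure q α β)}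
    (hv : IsJacobiEigen (gridBasis hq0 hq1 hα hβ) (offDiag q α β) (onDiag q α β) v 0) : v = 0 := by
  set b := gridBasis hq0 hq1 hα hβ with hb
  have hg : ∀ l, inner ℂ (b l) v = 0 := by
    refine eq_zero_of_jacobi_kernel hq0 hq1 hα hβ (M := ‖v‖) (fun l => ?_) fun l => ?_
    · simpa using hv l
    · simpa [b.orthonormal.1 l] using norm_inner_le_norm (𝕜 := ℂ) (b l) v
  have h := b.hasSum_norm_inner_sq v
  simp only [hg, norm_zero, ne_eq, OfNat.ofNat_ne_zero, not_false_eq_true, zero_pow] at h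
  have := h.unique hasSum_zero
  simpa using this

theorem mem_l2Span_of_ae_eq {ι : Type*} {μ : Measure ℝ} {f : ι → ℝ → ℂ} {g : Lp ℂ 2 μ} {i : ι}
    (h : g =ᵐ[μ] f i) : g ∈ l2Span μ f :=
  Submodule.subset_span ⟨i, h⟩

/-- Square integrable, nonzero eigenfunctions of `L` for distinct eigenvalues form an orthogonal
basis as soon as the squares of their eigenvalues sum to the squared Hilbert--Schmidt norm. -/
theorem isOrthogonalBasisL2_of_eigen (hq0 : 0 < q) (hq1 : q < 1) (hα : α ≠ 0) (hβ : 0 ≤ β)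
    {κ : Type*} {f : κ → ℝ → ℂ} {ev : κ → ℝ} (hev : Function.Injective ev)
    (hf : ∀ n, MemLp (f n) 2 (ascMeasure q α β)) (hf0 : ∀ n, ∃ l, f n (gridPoint q α l) ≠ 0)
    (he : ∀ n, IsGridEigen q α β (f n) (ev n))
    (hsum : HasSum (fun n => ev n ^ 2) ((1 + (β * q) ^ 2) / (1 - q ^ 2))) :
    IsOrthogonalBasisL2 (ascMeasure q α β) f := by
  have hne : ∀ n, ¬ f n =ᵐ[ascMeasure q α β] 0 := by
    intro n h
    obtain ⟨l, hl⟩ := hf0 n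
    exact hl ((ae_ascMeasure_iff hq0 hq1 hα hβ).1 h l)
  have hJ : ∀ n, IsJacobiEigen (gridBasis hq0 hq1 hα hβ) (offDiag q α β) (onDiag q α β)
      ((hf n).toLp (f n)) (ev n) :=
    fun n => (he n).isJacobiEigen hq0 hq1 hα hβ (hf n).coeFn_toLp
  obtain ⟨J, hjb⟩ := abs_offDiag_le hq0 hq1 hα hβ
  have horth : Pairwise fun m n => inner ℂ ((hf m).toLp (f m)) ((hf n).toLp (f n)) = 0 :=
    fun m n hmn => (hJ m).inner_eq_zero hjb (hJ n) (hev.ne hmn)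
  refine ⟨hf, hne, fun i j hij => ?_, ?_⟩
  · rw [← horth hij.symm, L2.inner_def]
    refine integral_congr_ae ?_
    filter_upwards [(hf i).coeFn_toLp, (hf j).coeFn_toLp] with x hi hj
    rw [hi, hj, RCLike.inner_apply]
  · rw [Submodule.topologicalClosure_eq_top_iff, Submodule.eq_bot_iff]
    intro v hv
    refine IsJacobiEigen.eq_zero_of_orthogonal (e := fun n => (hf n).toLp (f n)) (fun n h => ?_) hJ
      horth (hasSum_jacobi_sq hq0 hq1 hα hβ) hsum
      (fun v => eq_zero_of_isJacobiEigen_zero hq0 hq1 hα hβ) fun n => ?_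
    · exact hne n ((hf n).coeFn_toLp.symm.trans ((Lp.eq_zero_iff_ae_eq_zero).1 h))
    · exact (Submodule.mem_orthogonal _ _).1 hv _ (mem_l2Span_of_ae_eq (hf n).coeFn_toLp)

end

/-! ### Polynomials and the two families of eigenfunctions -/

section
variable {q α β : ℝ}

theorem memLp_polyFun (hq0 : 0 < q) (hq1 : q < 1) (hα : α ≠ 0) (hβ : 0 ≤ β) (p : ℂ[X]) :
    MemLp (polyFun p) 2 (ascMeasure q α β) := by
  induction p using Polynomial.induction_on' with
  | add p r hp hr =>
    have : polyFun (p + r) = polyFun p + polyFun r := by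
      ext x
      simp [polyFun]
    rw [this]
    exact hp.add hr
  | monomial n a =>
    rw [memLp_ascMeasure_iff hq0 hq1 hα hβ]
    refine ((summable_ascWeight_mul_pow hq0 hq1 hα hβ n).mul_left (‖a‖ ^ 2)).congr fun l => ?_
    rw [polyFun, eval_monomial, norm_mul, norm_pow, Complex.norm_real, Real.norm_eq_abs, mul_pow,
      ← abs_pow, sq_abs]
    ring

theorem ascFun_eq_polyFun (q β : ℝ) (n : ℕ) :
    ascFun q β n = polyFun ((symASC q β n).map Complex.ofRealHom) := by
  ext x
  rw [ascFun, polyFun, eval_map]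
  exact (eval₂_at_apply Complex.ofRealHom x).symm

theorem memLp_ascFun (hq0 : 0 < q) (hq1 : q < 1) (hα : α ≠ 0) (hβ : 0 ≤ β) (b : ℝ) (n : ℕ) :
    MemLp (ascFun q b n) 2 (ascMeasure q α β) := by
  rw [ascFun_eq_polyFun]
  exact memLp_polyFun hq0 hq1 hα hβ _

theorem memLp_ascDualFun (hq0 : 0 < q) (hq1 : q < 1) (hα : α ≠ 0) (hβ : 0 < β) (n : ℕ) :
    MemLp (ascDualFun q β n) 2 (ascMeasure q α β) := by
  obtain ⟨c, hc⟩ := exists_ascWeight_mul_ascPhi_sq hq0 hq1 hα hβ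
  have hβ' : 0 ≤ 1 / (β * q ^ 2) := by positivity
  have h := (memLp_ascMeasure_iff hq0 hq1 hα hβ').1
    (memLp_ascFun hq0 hq1 hα hβ' (1 / (β * q ^ 2)) n)
  rw [memLp_ascMeasure_iff hq0 hq1 hα hβ.le]
  refine (h.mul_left c).congr fun l => ?_
  rw [ascDualFun, norm_mul, mul_pow, ← mul_assoc, ← mul_assoc, hc]

theorem natDegree_symASC_le_and_coeff (q β : ℝ) (n : ℕ) :
    (symASC q β n).natDegree ≤ n ∧ (symASC q β n).coeff n = 2 ^ n := by
  induction n using Nat.twoStepInduction with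
  | zero => simp [symASC]
  | one =>
    have : (2 * X : ℝ[X]) = C 2 * X := rfl
    rw [symASC, this]
    exact ⟨(natDegree_C_mul_le _ _).trans natDegree_X_le, by simp⟩
  | more n ih0 ih1 =>
    have h2 : (2 * X : ℝ[X]) = C 2 * X := rfl
    rw [symASC, h2]
    constructor
    · refine (natDegree_sub_le _ _).trans (max_le ?_ ?_)
      · refine natDegree_mul_le.trans ?_
        have := (natDegree_C_mul_le (2 : ℝ) X).trans natDegree_X_le
        omega
      · exact (natDegree_C_mul_le _ _).trans (by omega)
    · rw [coeff_sub, coeff_C_mul, mul_assoc, coeff_C_mul, coeff_X_mul, ih1.2,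
        coeff_eq_zero_of_natDegree_lt (by omega : (symASC q β n).natDegree < n + 2)]
      ring

theorem symASC_ne_zero (q β : ℝ) (n : ℕ) : symASC q β n ≠ 0 := by
  intro h
  have := (natDegree_symASC_le_and_coeff q β n).2
  rw [h, coeff_zero] at this
  exact (pow_ne_zero n two_ne_zero) this.symm

theorem exists_ascFun_gridPoint_ne_zero (hq0 : 0 < q) (hq1 : q < 1) (hα : α ≠ 0) (b : ℝ) (n : ℕ) :
    ∃ l, ascFun q b n (gridPoint q α l) ≠ 0 := by
  by_contra! h
  refine symASC_ne_zero q b n (eq_zero_of_infinite_isRoot _ ?_)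
  refine (Set.infinite_range_of_injective (gridPoint_injective hq0 hq1 hα)).mono ?_
  rintro _ ⟨l, rfl⟩
  have := h l
  rw [ascFun] at this
  exact_mod_cast this

theorem ascPhi_ne_zero (hq0 : 0 < q) (hq1 : q < 1) (hβ : 0 < β) (x : ℝ) : ascPhi q β x ≠ 0 := by
  have hp1 : q ^ 2 < 1 := by nlinarith
  refine mul_ne_zero ?_ (Complex.exp_ne_zero _)
  have he := Real.exp_pos (-2 * Real.arsinh x)
  have h1 := qFacInf_pos (a := -Real.exp (-2 * Real.arsinh x) / β) (p := q ^ 2)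
    (by rw [neg_div]; have := div_pos he hβ; linarith) (by positivity) hp1
  have h2 := qFacInf_pos (a := -Real.exp (-2 * Real.arsinh x) * β * q ^ 2) (p := q ^ 2)
    (by have : 0 < Real.exp (-2 * Real.arsinh x) * β * q ^ 2 := by positivity
        linarith) (by positivity) hp1
  exact_mod_cast (div_pos h1 h2).ne'

/-- The span of the `h_n` contains `1` and, by the recurrence, is stable under multiplication by
`x`, hence contains all polynomials. -/
theorem polyFun_mem_span_ascFun (q β : ℝ) (p : ℂ[X]) :
    polyFun p ∈ Submodule.span ℂ (Set.range (ascFun q β)) := by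
  set S := Submodule.span ℂ (Set.range (ascFun q β)) with hS
  have hmem : ∀ n, ascFun q β n ∈ S := fun n => Submodule.subset_span ⟨n, rfl⟩
  have hX : ∀ f ∈ S, (fun x : ℝ => (x : ℂ) * f x) ∈ S := by
    intro f hf
    induction hf using Submodule.span_induction with
    | mem f hf =>
      obtain ⟨n, rfl⟩ := hf
      cases n with
      | zero =>
        have : (fun x : ℝ => (x : ℂ) * ascFun q β 0 x) = (2⁻¹ : ℂ) • ascFun q β 1 := by
          ext x
          simp [ascFun, symASC]
        rw [this]
        exact S.smul_mem _ (hmem 1)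
      | succ n =>
        have : (fun x : ℝ => (x : ℂ) * ascFun q β (n + 1) x) = (2⁻¹ : ℂ) • (ascFun q β (n + 2) +
            (((q ^ (n + 1))⁻¹ * (1 - q ^ (n + 1)) * (1 + β * (q ^ n)⁻¹) : ℝ) : ℂ) •
              ascFun q β n) := by
          ext x
          have h := symASC_eval_succ_succ q β x n
          simp only [ascFun, Pi.smul_apply, Pi.add_apply, smul_eq_mul]
          rw [h]
          push_cast
          ring
        rw [this]
        exact S.smul_mem _ (S.add_mem (hmem _) (S.smul_mem _ (hmem n)))
    | zero =>
      convert S.zero_mem using 1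
      ext x
      simp
    | add f g _ _ hf hg =>
      convert S.add_mem hf hg using 1
      ext x
      simp [mul_add]
    | smul a f _ hf =>
      convert S.smul_mem a hf using 1
      ext x
      simp [mul_left_comm]
  induction p using Polynomial.induction_on with
  | C a =>
    convert S.smul_mem a (hmem 0) using 1
    ext x
    simp [polyFun, ascFun, symASC]
  | add p r hp hr =>
    convert S.add_mem hp hr using 1
    ext x
    simp [polyFun]
  | monomial n a h =>
    convert hX _ h using 1
    ext x
    simp only [polyFun, eval_mul, eval_C, eval_pow, eval_X]
    ring

theorem exists_mem_l2Span_of_mem_span {ι : Type*} {μ : Measure ℝ} {f : ι → ℝ → ℂ}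
    (hf : ∀ i, MemLp (f i) 2 μ) {g : ℝ → ℂ} (hg : g ∈ Submodule.span ℂ (Set.range f)) :
    ∃ G ∈ l2Span μ f, G =ᵐ[μ] g := by
  induction hg using Submodule.span_induction with
  | mem g hg =>
    obtain ⟨i, rfl⟩ := hg
    exact ⟨(hf i).toLp _, mem_l2Span_of_ae_eq (hf i).coeFn_toLp, (hf i).coeFn_toLp⟩
  | zero => exact ⟨0, Submodule.zero_mem _, Lp.coeFn_zero _ _ _⟩
  | add f g _ _ hf hg =>
    obtain ⟨F, hF, hF'⟩ := hf
    obtain ⟨G, hG, hG'⟩ := hg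
    exact ⟨F + G, Submodule.add_mem _ hF hG, (Lp.coeFn_add F G).trans (hF'.add hG')⟩
  | smul a f _ hf =>
    obtain ⟨F, hF, hF'⟩ := hf
    exact ⟨a • F, Submodule.smul_mem _ a hF, (Lp.coeFn_smul a F).trans (hF'.const_smul a)⟩

theorem l2Span_polyFun_eq (hq0 : 0 < q) (hq1 : q < 1) (hα : α ≠ 0) (hβ : 0 ≤ β) :
    l2Span (ascMeasure q α β) polyFun = l2Span (ascMeasure q α β) (ascFun q β) := by
  refine le_antisymm (Submodule.span_le.2 ?_) (Submodule.span_mono ?_)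
  · rintro G ⟨p, hp⟩
    obtain ⟨F, hF, hF'⟩ := exists_mem_l2Span_of_mem_span (μ := ascMeasure q α β)
      (fun n => memLp_ascFun hq0 hq1 hα hβ β n) (polyFun_mem_span_ascFun q β p)
    have : G = F := Lp.ext (hp.trans hF'.symm)
    rwa [this]
  · rintro G ⟨n, hn⟩
    exact ⟨_, by rwa [← ascFun_eq_polyFun]⟩

theorem isOrthogonalBasisL2_ascFun_zero (hq0 : 0 < q) (hq1 : q < 1) (hα : α ≠ 0) :
    IsOrthogonalBasisL2 (ascMeasure q α 0) (ascFun q 0) := by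
  refine isOrthogonalBasisL2_of_eigen hq0 hq1 hα le_rfl
    (pow_right_injective₀ hq0 hq1.ne) (fun n => memLp_ascFun hq0 hq1 hα le_rfl 0 n)
    (exists_ascFun_gridPoint_ne_zero hq0 hq1 hα 0) (isGridEigen_ascFun 0 hq0 hα) ?_
  have h := hasSum_geometric_of_lt_one (by positivity) (by nlinarith : q ^ 2 < 1)
  simpa [← pow_mul, mul_comm] using h

theorem isOrthogonalBasisL2_elim (hq0 : 0 < q) (hq1 : q < 1) (hα : α ≠ 0) (hβ : 0 < β) :
    IsOrthogonalBasisL2 (ascMeasure q α β) (Sum.elim (ascFun q β) (ascDualFun q β)) := by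
  have hbq : 0 < β * q := by positivity
  have hinj := pow_right_injective₀ hq0 hq1.ne
  refine isOrthogonalBasisL2_of_eigen hq0 hq1 hα hβ.le
    (ev := Sum.elim (fun n => q ^ n) fun n => -(β * q) * q ^ n) ?_ ?_ ?_ ?_ ?_
  · refine Function.Injective.sumElim hinj (fun m n h => hinj ?_) fun m n h => ?_
    · exact mul_left_cancel₀ (neg_ne_zero.2 hbq.ne') h
    · have h1 := pow_pos hq0 m
      have h2 := mul_pos hbq (pow_pos hq0 n)
      linarith
  · rintro (n | n)
    · exact memLp_ascFun hq0 hq1 hα hβ.le β n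
    · exact memLp_ascDualFun hq0 hq1 hα hβ n
  · rintro (n | n)
    · exact exists_ascFun_gridPoint_ne_zero hq0 hq1 hα β n
    · obtain ⟨l, hl⟩ := exists_ascFun_gridPoint_ne_zero hq0 hq1 hα (1 / (β * q ^ 2)) n
      exact ⟨l, mul_ne_zero (ascPhi_ne_zero hq0 hq1 hβ _) hl⟩
  · rintro (n | n)
    · exact isGridEigen_ascFun β hq0 hα n
    · exact isGridEigen_ascDualFun hq0 hq1 hα hβ n
  · have h := hasSum_geometric_of_lt_one (by positivity) (by nlinarith : q ^ 2 < 1)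
    have h1 : HasSum (fun n : ℕ => (q ^ n) ^ 2) (1 - q ^ 2)⁻¹ := by
      simpa only [← pow_mul, mul_comm] using h
    have h2 := h1.mul_left ((β * q) ^ 2)
    have h3 := HasSum.sum (f := fun n : ℕ ⊕ ℕ =>
      (Sum.elim (fun n => q ^ n) (fun n => -(β * q) * q ^ n) n) ^ 2) h1
      (h2.congr_fun fun n => by simp only [Function.comp_apply, Sum.elim_inr]; ring)
    rwa [← one_add_mul, ← div_eq_mul_inv] at h3

end

theorem orthogonal_eq_topologicalClosure_of_dense_sup {H : Type*} [NormedAddCommGroup H]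
    [InnerProductSpace ℂ H] [CompleteSpace H] {K L : Submodule ℂ H} (hKL : L ≤ Kᗮ)
    (h : (K ⊔ L).topologicalClosure = ⊤) : Kᗮ = L.topologicalClosure := by
  refine le_antisymm (fun v hv => ?_)
    (L.topologicalClosure_minimal hKL (Submodule.isClosed_orthogonal K))
  rw [Submodule.topologicalClosure_eq_top_iff, ← Submodule.inf_orthogonal] at h
  obtain ⟨w, hw, z, hz, rfl⟩ := L.topologicalClosure.exists_add_mem_mem_orthogonal v
  have hw' := L.topologicalClosure_minimal hKL (Submodule.isClosed_orthogonal K) hw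
  have hzK : z ∈ Kᗮ := by simpa using Submodule.sub_mem _ hv hw'
  rw [Submodule.orthogonal_closure] at hz
  have : z ∈ Kᗮ ⊓ Lᗮ := ⟨hzK, hz⟩
  rw [h, Submodule.mem_bot] at this
  rwa [this, add_zero]

theorem l2Span_elim {ι κ : Type*} (μ : Measure ℝ) (f : ι → ℝ → ℂ) (g : κ → ℝ → ℂ) :
    l2Span μ (Sum.elim f g) = l2Span μ f ⊔ l2Span μ g := by
  rw [l2Span, l2Span, l2Span, ← Submodule.span_union]
  congr 1
  ext G
  simp [Sum.exists]

theorem l2Span_le_orthogonal {ι κ : Type*} {μ : Measure ℝ} {f : ι → ℝ → ℂ} {g : κ → ℝ → ℂ}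
    (h : ∀ i k, ∫ x, g k x * conj (f i x) ∂μ = 0) : l2Span μ g ≤ (l2Span μ f)ᗮ := by
  refine Submodule.span_le.2 ?_
  rintro G ⟨k, hG⟩
  rw [SetLike.mem_coe, Submodule.mem_orthogonal]
  intro F hF
  induction hF using Submodule.span_induction with
  | mem F hF =>
    obtain ⟨i, hF⟩ := hF
    rw [← h i k, L2.inner_def]
    refine integral_congr_ae ?_
    filter_upwards [hF, hG] with x h1 h2
    rw [h1, h2, RCLike.inner_apply]
  | zero => exact inner_zero_left _
  | add F F' _ _ h1 h2 => rw [inner_add_left, h1, h2, add_zero]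
  | smul a F _ h1 => rw [inner_smul_left, h1, mul_zero]

end

theorem mainTheorem1 (q α β : ℝ) (hq0 : 0 < q) (hq1 : q < 1) (hα : α ≠ 0) (hβ : 0 ≤ β) :
    IsProbabilityMeasure (ascMeasure q α β) ∧
    (∀ p : ℂ[X], MemLp (polyFun p) 2 (ascMeasure q α β)) ∧
    ((l2Span (ascMeasure q α β) polyFun).topologicalClosure = ⊤ ↔ β = 0) ∧
    (β = 0 → IsOrthogonalBasisL2 (ascMeasure q α β) (ascFun q 0)) ∧
    (0 < β →
      IsOrthogonalBasisL2 (ascMeasure q α β) (Sum.elim (ascFun q β) (ascDualFun q β)) ∧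
      (l2Span (ascMeasure q α β) polyFun)ᗮ =
        (l2Span (ascMeasure q α β) (ascDualFun q β)).topologicalClosure) := by
  have hcompl : 0 < β → (l2Span (ascMeasure q α β) polyFun)ᗮ =
      (l2Span (ascMeasure q α β) (ascDualFun q β)).topologicalClosure := by
    intro h
    obtain ⟨-, -, ho, hd⟩ := isOrthogonalBasisL2_elim hq0 hq1 hα h
    rw [l2Span_polyFun_eq hq0 hq1 hα hβ]
    refine orthogonal_eq_topologicalClosure_of_dense_sup ?_ (by rwa [← l2Span_elim])
    exact l2Span_le_orthogonal fun i k => ho (Sum.inr k) (Sum.inl i) (by simp)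
  refine ⟨isProbabilityMeasure_ascMeasure hq0 hq1 hα hβ, memLp_polyFun hq0 hq1 hα hβ,
    ⟨fun hdense => ?_, ?_⟩, ?_, fun h => ⟨isOrthogonalBasisL2_elim hq0 hq1 hα h, hcompl h⟩⟩
  · by_contra hβ0
    have hβ' : 0 < β := lt_of_le_of_ne hβ (Ne.symm hβ0)
    obtain ⟨hL, hne, -, -⟩ := isOrthogonalBasisL2_elim hq0 hq1 hα hβ'
    have hmem := Submodule.le_topologicalClosure _
      (mem_l2Span_of_ae_eq (f := ascDualFun q β) (i := 0) (hL (Sum.inr 0)).coeFn_toLp)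
    rw [← hcompl hβ', Submodule.topologicalClosure_eq_top_iff.1 hdense, Submodule.mem_bot] at hmem
    exact hne (Sum.inr 0)
      ((hL (Sum.inr 0)).coeFn_toLp.symm.trans (Lp.eq_zero_iff_ae_eq_zero.1 hmem))
  · rintro rfl
    rw [l2Span_polyFun_eq hq0 hq1 hα le_rfl]
    exact (isOrthogonalBasisL2_ascFun_zero hq0 hq1 hα).2.2.2
  · rintro rfl
    exact isOrthogonalBasisL2_ascFun_zero hq0 hq1 hα
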